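/- Setting. Let $T=(V,E)$ be a finite rooted tree with edge weights $w\ge 0$ whose root is the depot, in which every non-leaf vertex has exactly two children and whose leaves are exactly the terminals; let $1\le k\le |V|$ be an integer tour capacity. A tour is a closed walk at the depot together with the set of terminals on it that it visits (picks up), at most $k$ of them; its cost is the total weight of its edges, counted with multiplicity. A solution is a finite family of tours such that each terminal is visited by exactly one tour; $\mathrm{opt}$ is the minimum total cost of a solution. Let $D_{\min}$ and $D_{\max}$ be the minimum and the maximum distance between the depot and a terminal. The instance has bounded distances if $D_{\max}<(1/\epsilon)^{1/\epsilon-1}D_{\min}$. Put $\Gamma=12/\epsilon$ and $\alpha=\epsilon^{1/\epsilon+1}$. A decomposition into components is a partition of $E$ into the (nonempty) edge sets of a finite set $\mathcal C$ of connected subgraphs of $T$ (components) such that the following hold, where $r_c$ denotes the vertex of $c$ closest to the depot, and $c$ is called a leaf component if it contains all descendants of $r_c$, and an internal component otherwise. (a) A leaf component $c$ shares no vertex other than $r_c$ with other components. (b) An internal component $c$ has an exit vertex $e_c\ne r_c$ that it shares with another component, and it shares no vertex other than $r_c$ and $e_c$ with other components. (c) Each component contains at most $2\Gamma k$ terminals.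 (d) If $|\mathcal C|>1$ then, calling a component big if it contains at least $\Gamma k$ terminals, each leaf component is big; there is a map from all components to big components such that the image of each component is the component itself or one of its descendants (a component lying in the subtree of $T$ rooted at a vertex of $c$ other than $r_c$ is a descendant of $c$), and each big component has at most three preimages; and $|\mathcal C|$ is at most $3/\Gamma$ times the number of terminals. A dummy terminal is an additional terminal that belongs to a specified component $c$ and is placed at a vertex of $c$ that is not a leaf of $T$. The terminals in $c$ are the (real) terminals of $T$ in $c$ and the dummy terminals belonging to $c$. Theorem. Let $0<\epsilon\le 1/32$ and let the instance have bounded distances. Then a decomposition into components exists, and for every decomposition $\mathcal C$ into components there exist finitely many dummy terminals and a solution $\mathrm{OPT}_1$ (a finite family of tours, each visiting at most $k$ real and dummy terminals, such that each real and each dummy terminal is visited by exactly one tour) such that: 1. for each component $c\in\mathcal C$, there are at most $\frac{2\Gamma}{\alpha}+1$ tours of $\mathrm{OPT}_1$ visiting terminals in $c$; 2. for each component $c\in\mathcal C$ and each tour $t$ of $\mathrm{OPT}_1$ visiting terminals in $c$, the number of terminals in $c$ visited by $t$ is at least $\alpha k$; 3. the total cost of $\mathrm{OPT}_1$ is at most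 $(1+\epsilon)\cdot\mathrm{opt}$. -/

import Mathlib

noncomputable section

namespace TreeCVRP

open scoped Classical in
/-- The number of elements of a finite type with a given property. -/
def count {τ : Type*} [Fintype τ] (p : τ → Prop) : ℕ :=
  (Finset.univ.filter p).card

/-- The underlying graph of a rooted tree: every vertex other than the root `⊥` is joined to its
parent. In Mathlib's `RootedTree`, `u ≤ v` says that `u` is an ancestor of `v` (or `v` itself), and
the parent of `v` is the vertex covered by `v`. -/
abbrev graph (T : RootedTree) : SimpleGraph T := SimpleGraph.hasse T

/-- An instance of the unit demand capacitated vehicle routing problem on the finite rooted tree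
`T`. The depot is the root, every non-leaf vertex has exactly two children, and the terminals are
exactly the leaves, i.e. the maximal elements of the ancestor order. -/
structure Inst (T : RootedTree) [Fintype T] where
  /-- the edge weights -/
  weight : Sym2 T → ℝ
  weight_nonneg : ∀ e ∈ (graph T).edgeSet, 0 ≤ weight e
  /-- the tour capacity `k` -/
  cap : ℕ
  cap_pos : 1 ≤ cap
  cap_le : cap ≤ Fintype.card T
  two_children : ∀ v : T, ¬ IsMax v → count (fun u : T => v ⋖ u) = 2

/-- The (real) terminals: the leaves of the tree. -/
abbrev Terminal (T : RootedTree) : Type _ := {v : T // IsMax v}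

open scoped Classical in
instance (T : RootedTree) [Fintype T] : Fintype (Terminal T) := inferInstance

/-- A feasible family of tours for a finite set `τ` of tokens with positions `pos` in the tree and
tour capacity `k`. A tour is a closed walk at the depot, together with the set of the tokens that it
picks up ("visits"); it can pass through the position of a token without picking it up. -/
structure Solution (T : RootedTree) {τ : Type*} (pos : τ → T) (k : ℕ) where
  /-- the number of tours -/
  numTours : ℕ
  /-- the route of each tour -/
  walk : Fin numTours → (graph T).Walk ⊥ ⊥
  /-- the tokens picked up by each tour -/
  visits : Fin numTours → Finset τ
  mem_walk : ∀ i, ∀ x ∈ visits i, pos x ∈ (walk i).support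
  card_le : ∀ i, (visits i).card ≤ k
  visited_once : ∀ x, ∃! i, x ∈ visits i

namespace Inst

variable {T : RootedTree} [Fintype T] (I : Inst T)

/-- The cost of a walk: the total weight of its edges, with multiplicity. -/
def walkCost {u v : T} (p : (graph T).Walk u v) : ℝ :=
  (p.edges.map I.weight).sum

/-- The total cost of the tours of a solution. -/
def cost {τ : Type*} {pos : τ → T} {k : ℕ} (S : Solution T pos k) : ℝ :=
  ∑ i, I.walkCost (S.walk i)

/-- The optimal cost of the instance: the infimum, over all feasible solutions without dummy
terminals, of the cost. -/
def opt : ℝ :=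
  sInf (Set.range fun S : Solution T (fun v : Terminal T => v.1) I.cap => I.cost S)

open scoped Classical in
/-- The distance between the depot and `v`: the total weight of the edges from `u` to its parent,
over all vertices `u` other than the depot on the path from the depot to `v`. -/
def depotDist (v : T) : ℝ :=
  ∑ u ∈ Finset.univ.filter (fun u : T => u ≠ ⊥ ∧ u ≤ v), I.weight s(Order.pred u, u)

/-- The minimum distance between the depot and a terminal. -/
def Dmin : ℝ := ⨅ v : Terminal T, I.depotDist v.1

/-- The maximum distance between the depot and a terminal. -/
def Dmax : ℝ := ⨆ v : Terminal T, I.depotDist v.1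

/-- The instance has bounded distances (for the parameter `ε`). -/
def BoundedDistances (ε : ℝ) : Prop :=
  I.Dmax < (1 / ε) ^ (1 / ε - 1) * I.Dmin

end Inst

/-- `Γ = 12 / ε`. -/
def Gam (ε : ℝ) : ℝ := 12 / ε

/-- `α = ε ^ (1 / ε + 1)`. -/
def alpha (ε : ℝ) : ℝ := ε ^ (1 / ε + 1)

section Components

variable {T : RootedTree}

/-- `r` is the root vertex of `c`, the vertex of `c` closest to the depot. -/
def IsRootOf (c : (graph T).Subgraph) (r : T) : Prop := IsLeast c.verts r

/-- `c` is a leaf component: all descendants of its root vertex are in `c`. Otherwise `c` is an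
internal component. -/
def IsLeafComp (c : (graph T).Subgraph) : Prop :=
  ∃ r, IsRootOf c r ∧ ∀ v, r ≤ v → v ∈ c.verts

/-- `e` is the exit vertex of `c` among the components `𝒞`: it is a vertex of `c` other than the
root vertex, it belongs to another component as well, and `c` meets the other components in its
root vertex and in `e` only. -/
def IsExitOf (𝒞 : Finset (graph T).Subgraph) (c : (graph T).Subgraph) (e : T) : Prop :=
  e ∈ c.verts ∧ ¬ IsRootOf c e ∧ (∃ c' ∈ 𝒞, c' ≠ c ∧ e ∈ c'.verts) ∧
    ∀ c' ∈ 𝒞, c' ≠ c → ∀ v ∈ c.verts, v ∈ c'.verts → IsRootOf c v ∨ v = e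

/-- `c'` is a descendant of `c` (or `c` itself): all of `c'` lies in the subtree of `T` that is
rooted at some vertex of `c` other than the root vertex of `c`. -/
def IsDescendant (c' c : (graph T).Subgraph) : Prop :=
  c' = c ∨ ∃ v ∈ c.verts, ¬ IsRootOf c v ∧ ∀ u ∈ c'.verts, v ≤ u

variable [Fintype T]

/-- The number of (real) terminals in `c`. -/
def numTerminals (c : (graph T).Subgraph) : ℕ :=
  count (fun v : Terminal T => v.1 ∈ c.verts)

/-- `c` is big: it contains at least `Γ k` terminals. -/
def IsBig (ε : ℝ) (k : ℕ) (c : (graph T).Subgraph) : Prop :=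
  Gam ε * k ≤ numTerminals c

/-- `𝒞` is a decomposition of the tree into components for the parameter `ε` and tour
capacity `k`. -/
structure IsDecomposition (ε : ℝ) (k : ℕ) (𝒞 : Finset (graph T).Subgraph) : Prop where
  edges_nonempty : ∀ c ∈ 𝒞, c.edgeSet.Nonempty
  edge_partition : ∀ e ∈ (graph T).edgeSet, ∃! c, c ∈ 𝒞 ∧ e ∈ c.edgeSet
  connected : ∀ c ∈ 𝒞, c.Connected
  leaf_meets : ∀ c ∈ 𝒞, IsLeafComp c →
    ∀ c' ∈ 𝒞, c' ≠ c → ∀ v ∈ c.verts, v ∈ c'.verts → IsRootOf c v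
  internal_exit : ∀ c ∈ 𝒞, ¬ IsLeafComp c → ∃ e, IsExitOf 𝒞 c e
  terminals_le : ∀ c ∈ 𝒞, (numTerminals c : ℝ) ≤ 2 * Gam ε * k
  leaf_big : 1 < 𝒞.card → ∀ c ∈ 𝒞, IsLeafComp c → IsBig ε k c
  map_to_big : 1 < 𝒞.card → ∃ f : 𝒞 → 𝒞,
    (∀ c, IsBig ε k (f c).1 ∧ IsDescendant (f c).1 c.1) ∧
      ∀ b, count (fun c => f c = b) ≤ 3
  card_le : 1 < 𝒞.card → (𝒞.card : ℝ) ≤ 3 / Gam ε * Fintype.card (Terminal T)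

/-- Finitely many dummy terminals. Each one belongs to a component and is placed at a vertex of that
component that is an internal (non-leaf) vertex of the tree. -/
structure Dummies (𝒞 : Finset (graph T).Subgraph) where
  /-- the number of dummy terminals -/
  num : ℕ
  /-- the component of each dummy terminal -/
  comp : Fin num → 𝒞
  /-- the position of each dummy terminal -/
  pos : Fin num → T
  pos_mem : ∀ j, pos j ∈ (comp j).1.verts
  pos_internal : ∀ j, ¬ IsMax (pos j)

namespace Dummies

variable {𝒞 : Finset (graph T).Subgraph} (D : Dummies 𝒞)

/-- The real and the dummy terminals. -/
abbrev Token : Type _ := Terminal T ⊕ Fin D.num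

/-- The position of a real or dummy terminal. -/
def tokenPos : D.Token → T := Sum.elim (fun v => v.1) D.pos

/-- The real or dummy terminal `x` is a terminal in the component `c`. -/
def InComp (c : 𝒞) (x : D.Token) : Prop :=
  Sum.elim (fun v => v.1 ∈ c.1.verts) (fun j => D.comp j = c) x

/-- The number of (real and dummy) terminals in `c` visited by the `i`-th tour of `S`. -/
def numVisited {k : ℕ} (S : Solution T D.tokenPos k) (i : Fin S.numTours) (c : 𝒞) : ℕ :=
  count (fun x : D.Token => x ∈ S.visits i ∧ D.InComp c x)

end Dummies

end Components

end TreeCVRP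

end

/-!
The theorem has two independent parts.

**Every decomposition admits the solution.** By `exists_optimal`, an optimal solution is encoded by
a map `g` from the terminals to tours; each edge is then paid twice by every tour with a terminal
below it (`Inst.routeCost`). The *portion* of a tour in a component is the set of its terminals
there, and it is small if it has fewer than `a = α k` terminals. In each component, the small
portions of the tours that pass through the component to terminals below its exit vertex are grouped
greedily into groups of size in `[a, 2a)`, up to a leftover smaller than `a`, and likewise those of
the other tours. A group is a job that is shared by the tours contributing to it. The rounding lemma
`exists_rounding` (a circulation argument) gives every group to one of its tours, which overloads a
tour by at most `2a`. An overloaded tour drops at most two groups (`exists_relief`). The dropped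
groups of a component are packed into new tours `(c, j)` that are devoted to it; all but `(c, 0)`
are at least half full, and `(c, 0)` also takes the leftovers (`exists_repacking`). Dummy terminals
at the root vertex of `c` fill the tour `(c, 0)` up to `a`. Hence every portion has size at least
`a`, and the bound on the number of tours in a component follows from the bound on the number of its
terminals.

An old tour receives small portions only in components it visits, and portions of passing tours only
where it passes. Therefore the old tours together cost no more than before
(`IsSkeleton.numHits_le`), and what remains is the cost of the new tours (`IsSkeleton.new_cost_le`).
The tour `(c, 0)` reaches down to the exit vertex of `c`: its way to the root vertex of `c` is
charged to the terminals of a big component below (`IsDecomposition.sum_root_le`) through the radial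
lower bound `two_mul_sum_depotDist_le`, and the spine of `c` from its root vertex to its exit vertex
is used by at least `Γ` tours (`IsSkeleton.sum_spine_le`). The number of the other new tours is at
most `8 α` times `n / k`, where `n` is the number of terminals, and bounded distances make them
cheap.

**Decompositions exist.** A vertex is heavy if at least `M = Γ k` terminals lie below it. If the
depot is not heavy, the tree is a single component. Otherwise the tree is cut at a minimal set of
heavy vertices that contains the depot, all internal vertices whose children are all heavy (branch
vertices) and all lowest heavy vertices (tips), such that every stretch between cut vertices has at
most `2M` terminals (`IsCutSet`). By minimality, of two consecutive pieces that are separated by an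
optional cut vertex one has at least `M` terminals (`le_numTerminals_below`). So a piece that is not
big is charged to the next one, unless its exit vertex is a branch vertex; then it is charged to the
leaf component at a tip that is assigned to this branch vertex injectively (`exists_tip_of_branch`).
A big piece is charged at most three times: by itself, by the piece above it, and by the piece above
the branch vertex (`exists_map_to_big`).
-/

namespace TreeCVRP

/-! ### Counting -/

section Count

variable {τ : Type*} [Fintype τ]

lemma count_eq_card (p : τ → Prop) [DecidablePred p] : count p = (Finset.univ.filter p).card := by
  unfold count
  congr

lemma count_mono {p q : τ → Prop} (h : ∀ x, p x → q x) : count p ≤ count q := by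
  classical
  rw [count_eq_card, count_eq_card]
  exact Finset.card_le_card (Finset.monotone_filter_right _ fun x _ => h x)

end Count

/-! ### The ancestor order -/

section Trees

variable {T : RootedTree}

lemma le_or_le_of_le {x y z : T} (hx : x ≤ z) (hy : y ≤ z) : x ≤ y ∨ y ≤ x :=
  (le_total_of_directed hx hy).symm

lemma pred_covBy {v : T} (hv : v ≠ ⊥) : Order.pred v ⋖ v :=
  Order.pred_covBy_of_not_isMin fun h => hv h.eq_bot

lemma pred_lt {v : T} (hv : v ≠ ⊥) : Order.pred v < v := (pred_covBy hv).lt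

lemma adj_iff {u v : T} :
    (graph T).Adj u v ↔ (v ≠ ⊥ ∧ u = Order.pred v) ∨ (u ≠ ⊥ ∧ v = Order.pred u) := by
  have h : ∀ a b : T, a ⋖ b ↔ b ≠ ⊥ ∧ a = Order.pred b := fun a b =>
    ⟨fun h => ⟨(bot_le.trans_lt h.lt).ne', h.pred_eq.symm⟩, fun h => h.2 ▸ pred_covBy h.1⟩
  rw [SimpleGraph.hasse_adj, h, h]

lemma pred_adj {v : T} (hv : v ≠ ⊥) : (graph T).Adj (Order.pred v) v := Or.inl (pred_covBy hv)

/-- The edge from a vertex to its parent is the only way into its subtree. -/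
lemma eq_of_adj_of_le {u x v : T} (h : (graph T).Adj u x) (hu : ¬ v ≤ u) (hx : v ≤ x) :
    x = v ∧ u = Order.pred v ∧ v ≠ ⊥ := by
  rcases adj_iff.mp h with ⟨h0, rfl⟩ | ⟨h0, rfl⟩
  · rcases hx.eq_or_lt with rfl | hlt
    · exact ⟨rfl, rfl, h0⟩
    · exact absurd (Order.le_pred_of_lt hlt) hu
  · exact absurd (hx.trans (pred_lt h0).le) hu

lemma exists_edge {e : Sym2 T} (he : e ∈ (graph T).edgeSet) :
    ∃ v : T, v ≠ ⊥ ∧ e = s(Order.pred v, v) := by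
  induction e using Sym2.ind with
  | _ a b =>
    rcases adj_iff.mp ((SimpleGraph.mem_edgeSet _).mp he) with ⟨h0, rfl⟩ | ⟨h0, rfl⟩
    · exact ⟨b, h0, rfl⟩
    · exact ⟨a, h0, Sym2.eq_swap⟩

lemma edge_injective {v v' : T} (hv : v ≠ ⊥) (hv' : v' ≠ ⊥)
    (h : s(Order.pred v, v) = s(Order.pred v', v')) : v = v' := by
  rcases Sym2.eq_iff.mp h with ⟨_, h⟩ | ⟨h1, h2⟩
  · exact h
  · have := pred_lt hv
    have h3 := pred_lt hv'
    rw [h1, h2] at this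
    exact absurd this h3.not_gt

lemma exists_terminal_ge [Fintype T] (v : T) : ∃ x : Terminal T, v ≤ x.1 := by
  obtain ⟨x, hx, hmax⟩ := Finite.exists_le_maximal (p := fun x : T => v ≤ x) le_rfl
  exact ⟨⟨x, fun y hy => hmax.le_of_ge (hx.trans hy) hy⟩, hx⟩

lemma edge_mem_of_enters {v a b : T} (p : (graph T).Walk a b) (ha : ¬ v ≤ a) (hb : v ≤ b) :
    s(Order.pred v, v) ∈ p.edges := by
  induction p with
  | nil => exact absurd hb ha
  | @cons a c b h p ih =>
    rw [SimpleGraph.Walk.edges_cons, List.mem_cons]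
    by_cases hc : v ≤ c
    · obtain ⟨rfl, rfl, _⟩ := eq_of_adj_of_le h ha hc
      exact Or.inl rfl
    · exact Or.inr (ih hc hb)

open scoped Classical in
/-- A closed walk at the root which reaches the subtree of `v` uses the edge above `v` twice. -/
lemma two_le_count_edge {v x : T} (p : (graph T).Walk ⊥ ⊥) (hv : v ≠ ⊥) (hx : x ∈ p.support)
    (hvx : v ≤ x) : 2 ≤ p.edges.count s(Order.pred v, v) := by
  have hbot : ¬ v ≤ ⊥ := fun h => hv (le_bot_iff.mp h)
  rw [← p.take_spec hx, SimpleGraph.Walk.edges_append, List.count_append]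
  have h1 := List.count_pos_iff.mpr (edge_mem_of_enters (p.takeUntil x hx) hbot hvx)
  have h2 := edge_mem_of_enters (p.dropUntil x hx).reverse hbot hvx
  rw [SimpleGraph.Walk.edges_reverse, List.mem_reverse] at h2
  have h3 := List.count_pos_iff.mpr h2
  omega

/-- The number of tours that have to enter the subtree of `v` if the tokens at the positions `pos`
are distributed to tours by `G`. -/
noncomputable def numHits {τ ι : Type*} (pos : τ → T) (G : τ → ι) (v : T) : ℕ :=
  (G '' {x | v ≤ pos x}).ncard

open scoped Classical in
lemma numHits_eq_card {τ ι : Type*} [Fintype ι] (pos : τ → T) (G : τ → ι) (v : T) :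
    numHits pos G v = Finset.card {i | ∃ x, G x = i ∧ v ≤ pos x} := by
  rw [numHits, ← Set.ncard_coe_finset]
  congr 1
  ext i
  simp only [Set.mem_image, Set.mem_ofPred_eq, Finset.coe_filter, Finset.mem_univ, true_and]
  exact exists_congr fun x => and_comm

end Trees

/-! ### Costs of walks and of distributions to tours -/

section Costs

open Finset

variable {T : RootedTree} [Fintype T]

/-- The weight of the edge from `v` to its parent, and `0` for the root. -/
noncomputable def Inst.wt (I : Inst T) (v : T) : ℝ :=
  open scoped Classical in if v = ⊥ then 0 else I.weight s(Order.pred v, v)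

lemma Inst.wt_of_ne (I : Inst T) {v : T} (hv : v ≠ ⊥) : I.wt v = I.weight s(Order.pred v, v) :=
  if_neg hv

lemma Inst.wt_nonneg (I : Inst T) (v : T) : 0 ≤ I.wt v := by
  unfold Inst.wt
  split_ifs with h
  · exact le_rfl
  · exact I.weight_nonneg _ ((SimpleGraph.mem_edgeSet _).mpr (pred_adj h))

open scoped Classical in
lemma Inst.depotDist_eq (I : Inst T) (v : T) : I.depotDist v = ∑ u with u ≤ v, I.wt u := by
  unfold Inst.depotDist
  rw [← sum_filter_ne_zero (s := {u : T | u ≤ v}), filter_filter]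
  rw [← sum_filter_ne_zero]
  refine sum_congr ?_ fun u hu => ?_
  · ext u
    simp only [mem_filter, mem_univ, true_and]
    constructor
    · rintro ⟨⟨h1, h2⟩, h3⟩
      exact ⟨h2, by rwa [I.wt_of_ne h1]⟩
    · rintro ⟨h2, h3⟩
      have h1 : u ≠ ⊥ := fun h => h3 (if_pos h)
      exact ⟨⟨h1, h2⟩, by rwa [I.wt_of_ne h1] at h3⟩
  · simp only [mem_filter, mem_univ, true_and] at hu
    exact (I.wt_of_ne fun h => hu.2 (if_pos h)).symm

open scoped Classical in
lemma Inst.depotDist_mono (I : Inst T) {u v : T} (h : u ≤ v) : I.depotDist u ≤ I.depotDist v := by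
  rw [I.depotDist_eq, I.depotDist_eq]
  exact sum_le_sum_of_subset_of_nonneg
    (fun x hx => by simp only [mem_filter, mem_univ, true_and] at hx ⊢; exact hx.trans h)
    fun x _ _ => I.wt_nonneg x

lemma Inst.depotDist_nonneg (I : Inst T) (v : T) : 0 ≤ I.depotDist v := by
  rw [I.depotDist_eq]
  exact sum_nonneg fun x _ => I.wt_nonneg x

lemma Inst.depotDist_bot (I : Inst T) : I.depotDist ⊥ = 0 := by
  unfold Inst.depotDist
  refine sum_eq_zero fun u hu => ?_
  simp only [mem_filter, mem_univ, true_and] at hu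
  exact absurd (le_bot_iff.mp hu.2) hu.1

open scoped Classical in
/-- A closed walk at the root pays twice for every edge above one of its vertices. -/
lemma Inst.le_walkCost (I : Inst T) (p : (graph T).Walk ⊥ ⊥) :
    ∑ v with ∃ x ∈ p.support, v ≤ x, 2 * I.wt v ≤ I.walkCost p := by
  unfold Inst.walkCost
  have hmemE : ∀ e ∈ p.edges, e ∈ (graph T).edgeSet := fun e he => p.edges_subset_edgeSet he
  rw [sum_list_map_count]
  have h1 : ∑ v with ∃ x ∈ p.support, v ≤ x, 2 * I.wt v
      = ∑ v with v ≠ ⊥ ∧ ∃ x ∈ p.support, v ≤ x, 2 * I.wt v := by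
    refine (sum_subset (fun v hv => ?_) fun v hv hv' => ?_).symm
    · simp only [mem_filter, mem_univ, true_and] at hv ⊢
      exact hv.2
    · simp only [mem_filter, mem_univ, true_and, not_and] at hv hv'
      have : v = ⊥ := by_contra fun h => hv' h hv
      simp [Inst.wt, this]
  have hinj : Set.InjOn (fun v : T => s(Order.pred v, v))
      ({v | v ≠ ⊥ ∧ ∃ x ∈ p.support, v ≤ x} : Finset T) := fun v hv v' hv' h => by
    simp only [coe_filter, mem_univ, true_and, Set.mem_ofPred_eq] at hv hv'
    exact edge_injective hv.1 hv'.1 h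
  rw [h1]
  calc ∑ v with v ≠ ⊥ ∧ ∃ x ∈ p.support, v ≤ x, 2 * I.wt v
      ≤ ∑ v with v ≠ ⊥ ∧ ∃ x ∈ p.support, v ≤ x,
          p.edges.count s(Order.pred v, v) • I.weight s(Order.pred v, v) := by
        refine sum_le_sum fun v hv => ?_
        simp only [mem_filter, mem_univ, true_and] at hv
        obtain ⟨h0, x, hx, hvx⟩ := hv
        have h2 : (2 : ℝ) ≤ p.edges.count s(Order.pred v, v) := by
          exact_mod_cast two_le_count_edge p h0 hx hvx
        rw [nsmul_eq_mul, ← I.wt_of_ne h0]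
        exact mul_le_mul_of_nonneg_right h2 (I.wt_nonneg v)
    _ = ∑ e ∈ ({v | v ≠ ⊥ ∧ ∃ x ∈ p.support, v ≤ x} : Finset T).image
          (fun v => s(Order.pred v, v)), p.edges.count e • I.weight e :=
        (sum_image (f := fun e => p.edges.count e • I.weight e) hinj).symm
    _ ≤ _ := by
        refine sum_le_sum_of_subset_of_nonneg (fun e he => ?_) fun e he _ => ?_
        · simp only [mem_image, mem_filter, mem_univ, true_and] at he
          obtain ⟨v, ⟨h0, x, hx, hvx⟩, rfl⟩ := he
          rw [List.mem_toFinset]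
          exact List.count_pos_iff.mp (zero_lt_two.trans_le (two_le_count_edge p h0 hx hvx))
        · exact nsmul_nonneg (I.weight_nonneg e (hmemE e (List.mem_toFinset.mp he))) _

open scoped Classical in
/-- A set of vertices that is closed under ancestors is covered by a closed walk at the root which
uses each edge between its vertices twice (a depth-first traversal). -/
lemma Inst.exists_traversal (I : Inst T) (U : Finset T) (hU : ∀ u ∈ U, ∀ v ≤ u, v ∈ U) :
    ∃ p : (graph T).Walk ⊥ ⊥, (∀ u ∈ U, u ∈ p.support) ∧ I.walkCost p = ∑ u ∈ U, 2 * I.wt u := by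
  induction hn : #U generalizing U with
  | zero =>
    rw [card_eq_zero] at hn
    subst hn
    exact ⟨.nil, by simp, by simp [Inst.walkCost]⟩
  | succ n ih =>
    obtain ⟨m, hm⟩ := U.exists_maximal (card_pos.mp (by omega))
    have hlow : ∀ u ∈ U.erase m, ∀ v ≤ u, v ∈ U.erase m := by
      intro u hu v hvu
      obtain ⟨h1, h2⟩ := mem_erase.mp hu
      refine mem_erase.mpr ⟨fun h => h1 ?_, hU u h2 v hvu⟩
      subst h
      exact le_antisymm (hm.le_of_ge h2 hvu) hvu
    obtain ⟨p, hp, hcost⟩ := ih (U.erase m) hlow (by rw [card_erase_of_mem hm.prop]; omega)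
    by_cases h0 : m = ⊥
    · refine ⟨p, fun u hu => ?_, ?_⟩
      · by_cases hum : u = m
        · rw [hum, h0]; exact p.start_mem_support
        · exact hp u (mem_erase.mpr ⟨hum, hu⟩)
      · rw [hcost, sum_erase]
        simp [Inst.wt, h0]
    have hpm : Order.pred m ∈ p.support := hp _ (mem_erase.mpr
      ⟨(pred_lt h0).ne, hU m hm.prop _ (pred_lt h0).le⟩)
    -- The detour to `m` and back is inserted at the parent of `m`.
    refine ⟨(p.takeUntil _ hpm).append (.cons (pred_adj h0) (.cons (pred_adj h0).symm
      (p.dropUntil _ hpm))), fun u hu => ?_, ?_⟩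
    · by_cases hum : u = m
      · subst hum
        simp [SimpleGraph.Walk.mem_support_append_iff]
      · have := hp u (mem_erase.mpr ⟨hum, hu⟩)
        rw [← p.take_spec hpm, SimpleGraph.Walk.mem_support_append_iff] at this
        rw [SimpleGraph.Walk.mem_support_append_iff]
        rcases this with h | h
        · exact Or.inl h
        · exact Or.inr (by simp [h])
    · have h1 : I.walkCost p = I.walkCost (p.takeUntil _ hpm) + I.walkCost (p.dropUntil _ hpm) := by
        unfold Inst.walkCost
        rw [← List.sum_append, ← List.map_append, ← SimpleGraph.Walk.edges_append, p.take_spec]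
      have h2 : s(m, Order.pred m) = s(Order.pred m, m) := Sym2.eq_swap
      rw [← add_sum_erase _ _ hm.prop, ← hcost, h1, I.wt_of_ne h0]
      simp only [Inst.walkCost, SimpleGraph.Walk.edges_append, SimpleGraph.Walk.edges_cons,
        List.map_append, List.map_cons, List.sum_append, List.sum_cons, h2]
      ring

/-- The cost of the cheapest routes if the tokens at the positions `pos` are distributed to tours
by `G`: each edge is used twice by every tour that has a token below it. -/
noncomputable def Inst.routeCost (I : Inst T) {τ ι : Type*} (pos : τ → T) (G : τ → ι) : ℝ :=
  ∑ v, 2 * I.wt v * numHits pos G v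

open scoped Classical in
/-- A distribution of tokens to tours that respects the capacity is realized by the cheapest
routes. -/
lemma exists_solution (I : Inst T) {τ ι : Type*} [Fintype τ] [Fintype ι] (pos : τ → T) {k : ℕ}
    (G : τ → ι) (hG : ∀ i, count (fun x => G x = i) ≤ k) :
    ∃ (S : Solution T pos k) (e : Fin S.numTours ≃ ι), (∀ i x, x ∈ S.visits i ↔ G x = e i) ∧
      I.cost S = I.routeCost pos G := by
  have hw := fun i : ι => I.exists_traversal ({v | ∃ x, G x = i ∧ v ≤ pos x} : Finset T) (by
    intro u hu v hvu
    simp only [mem_filter, mem_univ, true_and] at hu ⊢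
    obtain ⟨x, hx, hux⟩ := hu
    exact ⟨x, hx, hvu.trans hux⟩)
  choose p hp hcost using hw
  let e := (Fintype.equivFin ι).symm
  refine ⟨⟨Fintype.card ι, fun i => p (e i), fun i => {x | G x = e i}, fun i x hx => ?_,
    fun i => (count_eq_card _).symm.trans_le (hG _),
    fun x => ⟨e.symm (G x), by simp, fun i hi => ?_⟩⟩, e, fun i x => by simp, ?_⟩
  · simp only [mem_filter, mem_univ, true_and] at hx
    exact hp _ _ (by simpa using ⟨x, hx, le_rfl⟩)
  · simp only [mem_filter, mem_univ, true_and] at hi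
    simp [hi]
  · unfold Inst.cost Inst.routeCost
    rw [Fintype.sum_equiv e _ (fun i => I.walkCost (p i)) fun i => rfl]
    simp only [hcost, sum_filter]
    rw [sum_comm]
    refine sum_congr rfl fun v _ => ?_
    rw [← sum_filter, sum_const, nsmul_eq_mul, mul_comm, numHits_eq_card]
    congr!

open scoped Classical in
/-- The optimum is attained by the cheapest routes of some distribution of the terminals to
tours; each tour is named by one of its terminals. -/
lemma exists_optimal (I : Inst T) : ∃ g : Terminal T → Terminal T,
    (∀ t, count (fun x => g x = t) ≤ I.cap) ∧
      I.routeCost (fun x : Terminal T => x.1) g ≤ I.opt := by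
  have hid : ∀ t : Terminal T, count (fun x : Terminal T => id x = t) ≤ I.cap := fun t => by
    refine le_trans ?_ I.cap_pos
    rw [count_eq_card, card_le_one]
    simp
  have : Nonempty {g : Terminal T → Terminal T // ∀ t, count (fun x => g x = t) ≤ I.cap} :=
    ⟨⟨id, hid⟩⟩
  obtain ⟨⟨g, hg⟩, hmin⟩ := Finite.exists_min
    fun g : {g : Terminal T → Terminal T // ∀ t, count (fun x => g x = t) ≤ I.cap} =>
      I.routeCost (fun x : Terminal T => x.1) g.1
  obtain ⟨S₀, _⟩ := exists_solution I (fun x : Terminal T => x.1) id hid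
  refine ⟨g, hg, le_csInf ⟨_, S₀, rfl⟩ ?_⟩
  rintro _ ⟨S, rfl⟩
  choose f hf hf' using S.visited_once
  have hX : Nonempty (Terminal T) := let ⟨x, _⟩ := exists_terminal_ge (⊥ : T); ⟨x⟩
  have hinv : ∀ x, f (Function.invFun f (f x)) = f x := fun x => Function.invFun_eq ⟨x, rfl⟩
  have h1 := hmin ⟨fun x => Function.invFun f (f x), fun t => by
    rw [count_eq_card]
    refine (card_le_card fun x hx => ?_).trans (S.card_le (f t))
    simp only [mem_filter, mem_univ, true_and] at hx
    rw [← hx, hinv]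
    exact hf x⟩
  refine h1.trans ?_
  have h2 : ∀ v, (numHits (fun x : Terminal T => x.1) (fun x => Function.invFun f (f x)) v : ℝ)
      ≤ #{i | ∃ x ∈ (S.walk i).support, v ≤ x} := fun v => by
    refine Nat.cast_le.mpr ?_
    unfold numHits
    rw [show (fun x => Function.invFun f (f x)) = Function.invFun f ∘ f from rfl, Set.image_comp,
      ← Set.ncard_coe_finset]
    refine (Set.ncard_image_le (Set.toFinite _)).trans (Set.ncard_le_ncard ?_ (Set.toFinite _))
    rintro _ ⟨x, hx, rfl⟩
    simpa using ⟨x.1, S.mem_walk _ x (hf x), hx⟩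
  calc I.routeCost (fun x : Terminal T => x.1) (fun x => Function.invFun f (f x))
      ≤ ∑ v, 2 * I.wt v * #{i | ∃ x ∈ (S.walk i).support, v ≤ x} :=
        sum_le_sum fun v _ => mul_le_mul_of_nonneg_left (h2 v) (by linarith [I.wt_nonneg v])
    _ = ∑ i, ∑ v with ∃ x ∈ (S.walk i).support, v ≤ x, 2 * I.wt v := by
        simp only [sum_filter]
        rw [sum_comm]
        refine sum_congr rfl fun v _ => ?_
        rw [← sum_filter, sum_const, nsmul_eq_mul, mul_comm]
    _ ≤ I.cost S := sum_le_sum fun i _ => I.le_walkCost _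

end Costs

/-! ### Rounding and packing -/

open Finset in
open scoped Classical in
/-- A bipartite edge set with at least as many edges as vertices carries a nonzero circulation: the
vertex constraints number `#A + #B`, and one of them is redundant. -/
lemma exists_circulation {α β : Type*} {A : Finset α} {B : Finset β} {E : Finset (α × β)}
    (hA : A.Nonempty) (hcard : #A + #B ≤ #E) :
    ∃ z : α × β → ℝ, (∀ p ∉ E, z p = 0) ∧ (∃ p ∈ E, z p < 0) ∧
      (∀ a ∈ A, ∑ b ∈ B, z (a, b) = 0) ∧ ∀ b ∈ B, ∑ a ∈ A, z (a, b) = 0 := by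
  obtain ⟨a₀, ha₀⟩ := hA
  let ext : (E → ℝ) →ₗ[ℝ] (α × β → ℝ) := Function.ExtendByZero.linearMap ℝ Subtype.val
  let Φ : (E → ℝ) →ₗ[ℝ] ((A.erase a₀ : Finset α) ⊕ B → ℝ) := LinearMap.pi fun i =>
    Sum.elim (fun a => ∑ b ∈ B, (LinearMap.proj (a.1, b)).comp ext)
      (fun b => ∑ a ∈ A, (LinearMap.proj (a, b.1)).comp ext) i
  have hlt : Module.finrank ℝ ((A.erase a₀ : Finset α) ⊕ B → ℝ) < Module.finrank ℝ (E → ℝ) := by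
    have := card_pos.mpr ⟨a₀, ha₀⟩
    simp only [Module.finrank_fintype_fun_eq_card, Fintype.card_sum, Fintype.card_coe,
      card_erase_of_mem ha₀]
    omega
  obtain ⟨z, hz, hz0⟩ := Submodule.exists_mem_ne_zero_of_ne_bot
    (LinearMap.ker_ne_bot_of_finrank_lt hlt)
  replace hz : Φ z = 0 := LinearMap.mem_ker.mp hz
  have hin : ∀ e : E, ext z e.1 = z e := fun e =>
    Function.Injective.extend_apply Subtype.val_injective _ _ _
  have hout : ∀ p ∉ E, ext z p = 0 := fun p hp => by
    refine Function.extend_apply' _ _ _ ?_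
    rintro ⟨e, rfl⟩
    exact hp e.2
  have hcol : ∀ b ∈ B, ∑ a ∈ A, ext z (a, b) = 0 := fun b hb => by
    have := congrFun hz (Sum.inr ⟨b, hb⟩)
    simpa [Φ] using this
  have hrow' : ∀ a ∈ A, a ≠ a₀ → ∑ b ∈ B, ext z (a, b) = 0 := fun a ha hne => by
    have := congrFun hz (Sum.inl ⟨a, mem_erase.mpr ⟨hne, ha⟩⟩)
    simpa [Φ] using this
  have hrow : ∀ a ∈ A, ∑ b ∈ B, ext z (a, b) = 0 := by
    intro a ha
    by_cases hne : a = a₀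
    · subst hne
      have h1 : ∑ a' ∈ A, ∑ b ∈ B, ext z (a', b) = 0 := by
        rw [sum_comm]; exact sum_eq_zero hcol
      rwa [sum_eq_single_of_mem a ha fun a' ha' h => hrow' a' ha' h] at h1
    · exact hrow' a ha hne
  obtain ⟨e, he⟩ : ∃ e, z e ≠ 0 := by
    by_contra! h
    exact hz0 (funext h)
  rcases lt_or_gt_of_ne he with h | h
  · exact ⟨ext z, hout, ⟨e.1, e.2, by rwa [hin]⟩, hrow, hcol⟩
  · refine ⟨-ext z, fun p hp => by simp [hout p hp], ⟨e.1, e.2, by simpa [hin] using h⟩,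
      fun a ha => ?_, fun b hb => ?_⟩
    · simpa using hrow a ha
    · simpa using hcol b hb

open Finset in
open scoped Classical in
/-- Rounding of a fractional assignment. Each job `b` is spread over the machines `a`, with `w a b`
of its size on `a`; it can be assigned to one machine of positive share such that the load of each
machine exceeds its fractional load by at most the maximum size of a job. The induction is on the
number of machines, jobs and positive shares. -/
lemma exists_rounding {α β : Type*} [Nonempty α] {M : ℝ} (hM : 0 ≤ M) (N : ℕ) :
    ∀ (A : Finset α) (B : Finset β) (w : α → β → ℝ), (∀ a b, 0 ≤ w a b) →
      (∀ b ∈ B, 0 < ∑ a ∈ A, w a b) → (∀ b ∈ B, ∑ a ∈ A, w a b ≤ M) →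
      #A + #B + #{p ∈ A ×ˢ B | 0 < w p.1 p.2} ≤ N →
      ∃ f : β → α, (∀ b ∈ B, f b ∈ A ∧ 0 < w (f b) b) ∧
        ∀ a ∈ A, ∑ b ∈ B with f b = a, ∑ a' ∈ A, w a' b ≤ ∑ b ∈ B, w a b + M := by
  induction N with
  | zero =>
    intro A B w _ _ _ hN
    have hA : A = ∅ := by rw [← card_eq_zero]; omega
    have hB : B = ∅ := by rw [← card_eq_zero]; omega
    subst hA hB
    exact ⟨fun _ => Classical.arbitrary α, by simp, by simp⟩
  | succ N ih =>
    intro A B w hw hpos hle hN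
    by_cases h1 : ∃ b₀ ∈ B, #{a ∈ A | 0 < w a b₀} ≤ 1
    · -- A job with a single machine goes there, at no loss.
      obtain ⟨b₀, hb₀, hdeg⟩ := h1
      obtain ⟨a₀, ha₀, hwa₀⟩ : ∃ a₀ ∈ A, 0 < w a₀ b₀ := by
        by_contra! h
        exact absurd (hpos b₀ hb₀) (not_lt.mpr (sum_nonpos h))
      have huniq : ∀ a ∈ A, a ≠ a₀ → w a b₀ = 0 := by
        intro a ha hne
        by_contra h
        exact hne (card_le_one.mp hdeg a (mem_filter.mpr ⟨ha, (hw a b₀).lt_of_ne' h⟩)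
          a₀ (mem_filter.mpr ⟨ha₀, hwa₀⟩))
      have hs : ∑ a ∈ A, w a b₀ = w a₀ b₀ := sum_eq_single_of_mem a₀ ha₀ huniq
      obtain ⟨f, hf, hload⟩ := ih A (B.erase b₀) w hw
        (fun b hb => hpos b (mem_of_mem_erase hb)) (fun b hb => hle b (mem_of_mem_erase hb)) (by
          have h2 := card_erase_lt_of_mem hb₀
          have h3 : #{p ∈ A ×ˢ B.erase b₀ | 0 < w p.1 p.2} ≤ #{p ∈ A ×ˢ B | 0 < w p.1 p.2} :=
            card_le_card (filter_subset_filter _ (product_subset_product_right (erase_subset _ _)))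
          omega)
      refine ⟨Function.update f b₀ a₀, fun b hb => ?_, fun a ha => ?_⟩
      · by_cases hbb : b = b₀
        · subst hbb; simp [ha₀, hwa₀]
        · rw [Function.update_of_ne hbb]; exact hf b (mem_erase.mpr ⟨hbb, hb⟩)
      · have h2 : ∑ b ∈ B.erase b₀ with Function.update f b₀ a₀ b = a, ∑ a' ∈ A, w a' b
            = ∑ b ∈ B.erase b₀ with f b = a, ∑ a' ∈ A, w a' b := by
          congr 1
          refine filter_congr fun b hb => ?_
          rw [Function.update_of_ne (ne_of_mem_erase hb)]
        have h3 := hload a ha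
        rw [← insert_erase hb₀, filter_insert, sum_insert (notMem_erase _ _)]
        by_cases haa : a₀ = a
        · subst haa
          rw [if_pos (by simp), sum_insert (by simp), h2, hs]
          linarith
        · rw [if_neg (by simpa using haa), h2]
          linarith [hw a b₀]
    by_cases h2 : ∃ a₀ ∈ A, #{b ∈ B | 0 < w a₀ b} ≤ 1
    · obtain ⟨a₀, ha₀, hdeg⟩ := h2
      have hcA := card_erase_lt_of_mem ha₀
      by_cases h0 : ∃ b₀ ∈ B, 0 < w a₀ b₀
      · -- A machine with a single job takes it; the other jobs have no share of that machine.
        obtain ⟨b₀, hb₀, hwb₀⟩ := h0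
        have hz : ∀ b ∈ B.erase b₀, w a₀ b = 0 := by
          intro b hb
          obtain ⟨hne, hbB⟩ := mem_erase.mp hb
          by_contra h
          exact hne (card_le_one.mp hdeg b (mem_filter.mpr ⟨hbB, (hw a₀ b).lt_of_ne' h⟩)
            b₀ (mem_filter.mpr ⟨hb₀, hwb₀⟩))
        have hs : ∀ b ∈ B.erase b₀, ∑ a ∈ A.erase a₀, w a b = ∑ a ∈ A, w a b := fun b hb =>
          sum_erase _ (hz b hb)
        obtain ⟨f, hf, hload⟩ := ih (A.erase a₀) (B.erase b₀) w hw
          (fun b hb => by rw [hs b hb]; exact hpos b (mem_of_mem_erase hb))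
          (fun b hb => by rw [hs b hb]; exact hle b (mem_of_mem_erase hb)) (by
            have h2 := card_erase_lt_of_mem hb₀
            have h3 : #{p ∈ A.erase a₀ ×ˢ B.erase b₀ | 0 < w p.1 p.2}
                ≤ #{p ∈ A ×ˢ B | 0 < w p.1 p.2} :=
              card_le_card (filter_subset_filter _
                (product_subset_product (erase_subset _ _) (erase_subset _ _)))
            omega)
        refine ⟨Function.update f b₀ a₀, fun b hb => ?_, fun a ha => ?_⟩
        · by_cases hbb : b = b₀
          · subst hbb; simp [ha₀, hwb₀]
          · rw [Function.update_of_ne hbb]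
            have := hf b (mem_erase.mpr ⟨hbb, hb⟩)
            exact ⟨mem_of_mem_erase this.1, this.2⟩
        · have h2 : ∑ b ∈ B.erase b₀ with Function.update f b₀ a₀ b = a, ∑ a' ∈ A, w a' b
              = ∑ b ∈ B.erase b₀ with f b = a, ∑ a' ∈ A, w a' b := by
            congr 1
            refine filter_congr fun b hb => ?_
            rw [Function.update_of_ne (ne_of_mem_erase hb)]
          by_cases haa : a₀ = a
          · subst haa
            have h4 : ∑ b ∈ B.erase b₀ with f b = a₀, ∑ a' ∈ A, w a' b = 0 := by
              rw [filter_eq_empty_iff.mpr fun b hb => ne_of_mem_erase (hf b hb).1, sum_empty]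
            have h5 := sum_nonneg fun b (_ : b ∈ B) => hw a₀ b
            rw [← insert_erase hb₀, filter_insert, if_pos (by simp), sum_insert (by simp), h2, h4,
              insert_erase hb₀]
            linarith [hle b₀ hb₀]
          · have h3 := hload a (mem_erase.mpr ⟨fun h => haa h.symm, ha⟩)
            rw [sum_congr rfl fun b hb => hs b (mem_filter.mp hb).1] at h3
            rw [← insert_erase hb₀, filter_insert, sum_insert (notMem_erase _ _),
              if_neg (by simpa using haa), h2]
            linarith [hw a b₀]
      · push Not at h0
        have hz : ∀ b ∈ B, w a₀ b = 0 := fun b hb => le_antisymm (h0 b hb) (hw a₀ b)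
        have hs : ∀ b ∈ B, ∑ a ∈ A.erase a₀, w a b = ∑ a ∈ A, w a b := fun b hb =>
          sum_erase _ (hz b hb)
        obtain ⟨f, hf, hload⟩ := ih (A.erase a₀) B w hw
          (fun b hb => by rw [hs b hb]; exact hpos b hb)
          (fun b hb => by rw [hs b hb]; exact hle b hb) (by
            have h3 : #{p ∈ A.erase a₀ ×ˢ B | 0 < w p.1 p.2} ≤ #{p ∈ A ×ˢ B | 0 < w p.1 p.2} :=
              card_le_card (filter_subset_filter _ (product_subset_product_left (erase_subset _ _)))
            omega)
        refine ⟨f, fun b hb => ⟨mem_of_mem_erase (hf b hb).1, (hf b hb).2⟩, fun a ha => ?_⟩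
        by_cases haa : a = a₀
        · subst haa
          rw [filter_eq_empty_iff.mpr fun b hb => ne_of_mem_erase (hf b hb).1, sum_empty]
          have h5 := sum_nonneg fun b (_ : b ∈ B) => hw a b
          linarith
        · have h3 := hload a (mem_erase.mpr ⟨haa, ha⟩)
          rwa [sum_congr rfl fun b hb => hs b (mem_filter.mp hb).1] at h3
    push Not at h1 h2
    by_cases hBe : B = ∅
    · subst hBe
      exact ⟨fun _ => Classical.arbitrary α, by simp, by simpa using fun _ _ => hM⟩
    obtain ⟨b₁, hb₁⟩ := nonempty_iff_ne_empty.mpr hBe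
    have hAne : A.Nonempty := by
      by_contra h
      rw [not_nonempty_iff_eq_empty] at h
      subst h
      simpa using hpos b₁ hb₁
    -- All degrees are at least two, so there are at least as many shares as machines and jobs, and
    -- the shares can be shifted along a circulation until one of them vanishes.
    set E := {p ∈ A ×ˢ B | 0 < w p.1 p.2} with hEdef
    have hEA : 2 * #A ≤ #E := by
      have : #E = ∑ a ∈ A, #{b ∈ B | 0 < w a b} := by
        simp only [hEdef, card_filter, sum_product]
      rw [this, mul_comm]
      exact card_nsmul_le_sum A _ 2 fun a ha => h2 a ha
    have hEB : 2 * #B ≤ #E := by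
      have : #E = ∑ b ∈ B, #{a ∈ A | 0 < w a b} := by
        simp only [hEdef, card_filter, sum_product_right]
      rw [this, mul_comm]
      exact card_nsmul_le_sum B _ 2 fun b hb => h1 b hb
    obtain ⟨z, hzout, ⟨p₁, hp₁, hzp₁⟩, hrow, hcol⟩ :=
      exists_circulation (B := B) (E := E) hAne (by omega)
    obtain ⟨q, hq, hqmin⟩ := exists_min_image {p ∈ E | z p < 0} (fun p => w p.1 p.2 / -z p)
      ⟨p₁, mem_filter.mpr ⟨hp₁, hzp₁⟩⟩
    obtain ⟨hqE, hzq⟩ := mem_filter.mp hq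
    have hwE : ∀ p ∈ E, 0 < w p.1 p.2 := fun p hp => (mem_filter.mp hp).2
    set δ := w q.1 q.2 / -z q with hδ
    have hδ0 : 0 < δ := div_pos (hwE q hqE) (by linarith)
    have hw' : ∀ a b, 0 ≤ w a b + δ * z (a, b) := by
      intro a b
      by_cases hE : (a, b) ∈ E
      · by_cases hn : z (a, b) < 0
        · have := hqmin (a, b) (mem_filter.mpr ⟨hE, hn⟩)
          rw [le_div_iff₀ (by linarith)] at this
          linarith
        · have := mul_nonneg hδ0.le (not_lt.mp hn)
          linarith [hw a b]
      · simpa [hzout _ hE] using hw a b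
    have hsc : ∀ b ∈ B, ∑ a ∈ A, (w a b + δ * z (a, b)) = ∑ a ∈ A, w a b := by
      intro b hb
      rw [sum_add_distrib, ← mul_sum, hcol b hb]; simp
    have hsr : ∀ a ∈ A, ∑ b ∈ B, (w a b + δ * z (a, b)) = ∑ b ∈ B, w a b := by
      intro a ha
      rw [sum_add_distrib, ← mul_sum, hrow a ha]; simp
    have hsub : ∀ a b, 0 < w a b + δ * z (a, b) → 0 < w a b := by
      intro a b h
      by_cases hE : (a, b) ∈ E
      · exact hwE _ hE
      · simpa [hzout _ hE] using h
    have hlt : #{p ∈ A ×ˢ B | 0 < w p.1 p.2 + δ * z (p.1, p.2)} < #E := by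
      refine card_lt_card ((ssubset_iff_of_subset fun p hp => ?_).mpr ⟨q, hqE, ?_⟩)
      · obtain ⟨h3, h4⟩ := mem_filter.mp hp
        exact mem_filter.mpr ⟨h3, hsub _ _ h4⟩
      · rw [mem_filter, not_and]
        intro _
        have : δ * z q = -w q.1 q.2 := by
          rw [hδ]; field_simp [hzq.ne]
        simp [this]
    obtain ⟨f, hf, hload⟩ := ih A B (fun a b => w a b + δ * z (a, b)) hw'
      (fun b hb => by rw [hsc b hb]; exact hpos b hb)
      (fun b hb => by rw [hsc b hb]; exact hle b hb) (by
        have hN' : #A + #B + #E ≤ N + 1 := hN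
        exact Nat.le_of_lt_succ ((Nat.add_lt_add_left hlt (#A + #B)).trans_le hN'))
    refine ⟨f, fun b hb => ⟨(hf b hb).1, hsub _ _ (hf b hb).2⟩, fun a ha => ?_⟩
    have h3 := hload a ha
    rwa [hsr a ha, sum_congr rfl fun b hb => hsc b (mem_filter.mp hb).1] at h3

open Finset in
open scoped Classical in
/-- Greedy packing: items of size at most `u` are packed into bins of size less than `θ + u`, and
all bins but the bin `0` are filled to at least `θ`. -/
lemma exists_packing {β : Type*} (s : β → ℝ) {u θ : ℝ} (hθ : 0 < θ) (P : Finset β)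
    (h0 : ∀ b ∈ P, 0 ≤ s b) (hu : ∀ b ∈ P, s b ≤ u) :
    ∃ (h : β → ℕ) (M : ℕ), (∀ b, h b ≤ M) ∧ ∑ b ∈ P with h b = 0, s b < θ ∧
      ∀ j, 1 ≤ j → j ≤ M → θ ≤ ∑ b ∈ P with h b = j, s b ∧ ∑ b ∈ P with h b = j, s b < θ + u := by
  induction P using Finset.induction_on with
  | empty => exact ⟨fun _ => 0, 0, by simp, by simpa using hθ, fun j h1 h2 => by omega⟩
  | insert b P hb ih =>
    obtain ⟨h, M, hM, hz, hj⟩ := ih (fun b hb => h0 b (mem_insert_of_mem hb))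
      (fun b hb => hu b (mem_insert_of_mem hb))
    have hsb := hu b (mem_insert_self _ _)
    have hcongr : ∀ j, ∑ x ∈ P with Function.update h b 0 x = j, s x
        = ∑ x ∈ P with h x = j, s x := by
      intro j
      congr 1
      refine filter_congr fun x hx => ?_
      rw [Function.update_of_ne (ne_of_mem_of_not_mem hx hb)]
    have hins0 : ∑ x ∈ insert b P with Function.update h b 0 x = 0, s x
        = s b + ∑ x ∈ P with h x = 0, s x := by
      rw [filter_insert, if_pos (by simp), sum_insert (by simp [hb]), hcongr]
    have hins : ∀ j, 1 ≤ j → ∑ x ∈ insert b P with Function.update h b 0 x = j, s x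
        = ∑ x ∈ P with h x = j, s x := by
      intro j hj
      rw [filter_insert, if_neg (by simp; omega), hcongr]
    have hM' : ∀ x, Function.update h b 0 x ≤ M := by
      intro x
      by_cases hx : x = b
      · subst hx; simp
      · rw [Function.update_of_ne hx]; exact hM x
    generalize Function.update h b 0 = h' at *
    by_cases hlt : s b + ∑ x ∈ P with h x = 0, s x < θ
    · refine ⟨h', M, hM', by rw [hins0]; exact hlt, fun j h1 h2 => ?_⟩
      rw [hins j h1]; exact hj j h1 h2
    · -- The open bin is full now: it is closed under the new label `M + 1`.
      refine ⟨fun x => if h' x = 0 then M + 1 else h' x, M + 1, fun x => ?_, ?_, fun j h1 h2 => ?_⟩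
      · have := hM' x
        dsimp only
        split_ifs <;> omega
      · rw [filter_eq_empty_iff.mpr fun x _ => ?_]
        · simpa using hθ
        · by_cases hx : h' x = 0 <;> simp [hx]
      · by_cases hjM : j = M + 1
        · subst hjM
          have : {x ∈ insert b P | (if h' x = 0 then M + 1 else h' x) = M + 1}
              = {x ∈ insert b P | h' x = 0} := by
            refine filter_congr fun x _ => ?_
            have := hM' x
            split_ifs <;> omega
          rw [this, hins0]
          constructor <;> linarith
        · have : {x ∈ insert b P | (if h' x = 0 then M + 1 else h' x) = j}
              = {x ∈ insert b P | h' x = j} := by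
            refine filter_congr fun x _ => ?_
            by_cases hx : h' x = 0
            · simp only [hx, if_true]; omega
            · simp only [hx, if_false]
          rw [this, hins j h1]
          exact hj j h1 (by omega)

/-! ### Repacking the portions of the tours -/

open Finset in
open scoped Classical in
/-- An overload of at most `2 * a` is removed by dropping at most two items, as each item has size
between `a` and `2 * a`. -/
lemma exists_relief {β : Type*} (D : Finset β) (s : β → ℝ) {a k base : ℝ} (ha0 : 0 ≤ a)
    (ha : ∀ q ∈ D, a ≤ s q) (ha2 : ∀ q ∈ D, s q ≤ 2 * a) (hb : base ≤ k)
    (hl : base + ∑ q ∈ D, s q ≤ k + 2 * a) :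
    ∃ R D' : Finset β, R ⊆ D ∧ (∀ q, q ∈ D' ↔ q ∈ D ∧ q ∉ R) ∧ ∑ q ∈ R, s q ≤ 4 * a ∧
      base + ∑ q ∈ D', s q ≤ k ∧ (base + ∑ q ∈ D, s q ≤ k → R = ∅) := by
  by_cases hk : base + ∑ q ∈ D, s q ≤ k
  · exact ⟨∅, D, empty_subset _, by simp, by simpa using ha0, hk, fun _ => rfl⟩
  by_cases hD : #D ≤ 2
  · refine ⟨D, ∅, subset_rfl, by simp, ?_, by simpa using hb, fun h => absurd h hk⟩
    have h1 : ∑ q ∈ D, s q ≤ #D • (2 * a) := sum_le_card_nsmul _ _ _ ha2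
    have h2 : (#D : ℝ) ≤ 2 := by exact_mod_cast hD
    rw [nsmul_eq_mul] at h1
    nlinarith
  · obtain ⟨R, hR, hcard⟩ := exists_subset_card_eq (show 2 ≤ #D by omega)
    refine ⟨R, D \ R, hR, fun q => mem_sdiff, ?_, ?_, fun h => absurd h hk⟩
    · have h1 : ∑ q ∈ R, s q ≤ #R • (2 * a) := sum_le_card_nsmul _ _ _ fun q hq => ha2 q (hR hq)
      rw [hcard, nsmul_eq_mul] at h1
      push_cast at h1
      linarith
    · have h1 : #R • a ≤ ∑ q ∈ R, s q := card_nsmul_le_sum _ _ _ fun q hq => ha q (hR hq)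
      rw [hcard, nsmul_eq_mul] at h1
      push_cast at h1
      have h2 := sum_sdiff (f := s) hR
      linarith

open Finset in
open scoped Classical in
/-- Repacking of the portions `(t, c)` of size `n t c`, the part of tour `t` in component `c`. A
portion goes to an old tour (`Sum.inl`) or to a new tour `Sum.inr (c, j)`, `j ≤ m c`, which is
devoted to the component `c`. An old tour receives portions only from components that it visits, and
portions of passing tours only where it passes itself. All tours respect the capacity `k`, and in
every component each tour has nothing or at least `a`, except for the new tours `(c, 0)`. The number
of the other new tours is at most `8 * a / k` times the number of full loads. -/
lemma exists_repacking {ι C : Type*} [Fintype ι] [Nonempty ι] [Fintype C] (n : ι → C → ℝ)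
    (pass : ι → C → Prop) {a k : ℝ} (ha : 0 < a) (hak : 4 * a ≤ k) (hn : ∀ t c, 0 ≤ n t c)
    (hcap : ∀ t, ∑ c, n t c ≤ k) :
    ∃ (F : ι → C → ι ⊕ C × ℕ) (m : C → ℕ),
      (∀ t c t', 0 < n t c → F t c = Sum.inl t' → 0 < n t' c ∧ (pass t c → pass t' c)) ∧
      (∀ t c c' j, F t c = Sum.inr (c', j) → c' = c ∧ j ≤ m c) ∧
      (∀ t', ∑ t, ∑ c, (if F t c = Sum.inl t' then n t c else 0) ≤ k) ∧
      (∀ c j, ∑ t, (if F t c = Sum.inr (c, j) then n t c else 0) ≤ k) ∧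
      (∀ t c, 0 < n t c → F t c ≠ Sum.inr (c, 0) →
        a ≤ ∑ t', (if F t' c = F t c then n t' c else 0)) ∧
      (∑ c, (m c : ℝ)) * k ^ 2 ≤ 8 * a * ∑ t, ∑ c, n t c := by
  have hk : 0 < k := by linarith
  -- The small portions of a component and a kind (passing or not) are grouped to sizes in
  -- `[a, 2a)`; the group `0` is a leftover of size less than `a`.
  have hgrp := fun cls : C × Bool => exists_packing (fun t => n t cls.1) (u := a) ha
    {t | n t cls.1 < a ∧ decide (pass t cls.1) = cls.2} (fun t _ => hn t _)
    (fun t ht => (mem_filter.mp ht).2.1.le)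
  choose h M₁ hM₁ hz₁ hj₁ using hgrp
  let job : ι → C → (_ : C × Bool) × ℕ := fun t c =>
    ⟨(c, decide (pass t c)), h (c, decide (pass t c)) t⟩
  have hjobc : ∀ t c, (job t c).1.1 = c := fun t c => rfl
  let B : Finset ((_ : C × Bool) × ℕ) := univ.sigma fun cls => Icc 1 (M₁ cls)
  have hB : ∀ q, q ∈ B ↔ 1 ≤ q.2 ∧ q.2 ≤ M₁ q.1 := fun q => by simp [B]
  have hjobB : ∀ t c, (job t c).2 ≠ 0 → job t c ∈ B := fun t c h0 =>
    (hB _).mpr ⟨Nat.one_le_iff_ne_zero.mpr h0, hM₁ _ _⟩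
  let w : ι → (_ : C × Bool) × ℕ → ℝ := fun t q =>
    ∑ c, if n t c < a ∧ job t c = q then n t c else 0
  have hw0 : ∀ t q, 0 ≤ w t q := fun t q => sum_nonneg fun c _ => by
    split_ifs
    · exact hn t c
    · exact le_rfl
  have hw1 : ∀ t q, w t q = if n t q.1.1 < a ∧ job t q.1.1 = q then n t q.1.1 else 0 := by
    intro t q
    refine sum_eq_single_of_mem _ (mem_univ _) fun c _ hc => if_neg ?_
    rintro ⟨-, rfl⟩
    exact hc rfl
  let s : (_ : C × Bool) × ℕ → ℝ := fun q => ∑ t, w t q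
  have hs : ∀ cls j, s ⟨cls, j⟩ =
      ∑ t ∈ ({t | n t cls.1 < a ∧ decide (pass t cls.1) = cls.2} : Finset ι) with h cls t = j,
        n t cls.1 := by
    rintro ⟨c, b⟩ j
    rw [filter_filter, sum_filter]
    refine sum_congr rfl fun t _ => ?_
    rw [hw1]
    refine if_congr ?_ rfl rfl
    simp only [job]
    constructor
    · rintro ⟨h1, h2⟩
      simp only [Sigma.mk.injEq, Prod.mk.injEq, true_and, heq_eq_eq] at h2
      obtain ⟨h2, h3⟩ := h2
      subst h2
      exact ⟨⟨h1, rfl⟩, h3⟩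
    · rintro ⟨⟨h1, h2⟩, h3⟩
      refine ⟨h1, ?_⟩
      rw [show decide (pass t c) = b from h2, show h (c, b) t = j from h3]
  have hsa : ∀ q ∈ B, a ≤ s q := fun q hq => by
    obtain ⟨h1, h2⟩ := (hB q).mp hq
    rw [show q = ⟨q.1, q.2⟩ from rfl, hs]
    exact (hj₁ q.1 q.2 h1 h2).1
  have hs2a : ∀ q ∈ B, s q ≤ 2 * a := fun q hq => by
    obtain ⟨h1, h2⟩ := (hB q).mp hq
    rw [show q = ⟨q.1, q.2⟩ from rfl, hs]
    linarith [(hj₁ q.1 q.2 h1 h2).2]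
  obtain ⟨f, hf, hload⟩ := exists_rounding (M := 2 * a) (by linarith) _ univ B w hw0
    (fun b hb => ha.trans_le (hsa b hb)) hs2a le_rfl
  -- The load of a tour before the correction of capacities.
  let big : ι → ℝ := fun t => ∑ c, if a ≤ n t c then n t c else 0
  have hbigw : ∀ t, big t + ∑ q ∈ B, w t q ≤ ∑ c, n t c := by
    intro t
    rw [sum_comm, ← sum_add_distrib]
    refine sum_le_sum fun c _ => ?_
    by_cases hc : a ≤ n t c
    · rw [if_pos hc, sum_eq_zero fun q _ => if_neg fun h => absurd h.1 (not_lt.mpr hc), add_zero]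
    · rw [if_neg hc, zero_add]
      simp only [not_le.mp hc, true_and, sum_ite_eq]
      split_ifs
      · exact le_rfl
      · exact hn t c
  have hw_sum0 : ∀ t, 0 ≤ ∑ q ∈ B, w t q := fun t => sum_nonneg fun q _ => hw0 t q
  have hrel := fun t : ι => exists_relief {q ∈ B | f q = t} s (a := a) (k := k) (base := big t)
    ha.le (fun q hq => hsa q (mem_filter.mp hq).1) (fun q hq => hs2a q (mem_filter.mp hq).1)
    (by linarith [hbigw t, hw_sum0 t, hcap t])
    (by linarith [hbigw t, hload t (mem_univ t), hcap t])
  choose R D hRsub hD hR4 hRk hRe using hrel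
  let Rem : Finset ((_ : C × Bool) × ℕ) := {q ∈ B | q ∈ R (f q)}
  have hs0 : ∀ q, 0 ≤ s q := fun q => sum_nonneg fun t _ => hw0 t q
  have htot : ∑ t, (big t + ∑ q ∈ B with f q = t, s q) ≤ ∑ t, ∑ c, n t c := by
    have h1 : ∑ t, ∑ q ∈ B with f q = t, s q = ∑ t, ∑ q ∈ B, w t q :=
      (sum_fiberwise B f s).trans sum_comm
    rw [sum_add_distrib, h1, ← sum_add_distrib]
    exact sum_le_sum fun t _ => hbigw t
  have hbig0 : ∀ t, 0 ≤ big t := fun t => sum_nonneg fun c _ => by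
    split_ifs
    · exact hn t c
    · exact le_rfl
  have hRem : (∑ q ∈ Rem, s q) * k ≤ 4 * a * ∑ t, ∑ c, n t c := by
    have h1 : ∑ q ∈ Rem, s q = ∑ t, ∑ q ∈ R t, s q := by
      rw [← sum_fiberwise Rem f]
      refine sum_congr rfl fun t _ => ?_
      congr 1
      ext q
      simp only [Rem, mem_filter]
      constructor
      · rintro ⟨⟨_, h2⟩, rfl⟩; exact h2
      · intro hq
        obtain ⟨h2, h3⟩ := mem_filter.mp (hRsub t hq)
        subst h3
        exact ⟨⟨h2, hq⟩, rfl⟩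
    rw [h1, sum_mul]
    refine le_trans (sum_le_sum fun t _ => ?_)
      ((mul_sum _ _ _).symm.le.trans (mul_le_mul_of_nonneg_left htot (by linarith)))
    have hl0 : 0 ≤ big t + ∑ q ∈ B with f q = t, s q :=
      add_nonneg (hbig0 t) (sum_nonneg fun q _ => hs0 q)
    by_cases hlk : big t + ∑ q ∈ B with f q = t, s q ≤ k
    · rw [hRe t hlk]
      simp only [sum_empty, zero_mul]
      positivity
    · push Not at hlk
      have := hR4 t
      nlinarith
  have hbin := fun c : C => exists_packing s (u := 2 * a) (θ := k / 2) (by linarith)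
    {q ∈ Rem | q.1.1 = c} (fun q _ => hs0 q)
    (fun q hq => hs2a q (mem_filter.mp (mem_filter.mp hq).1).1)
  choose g m hgm hg0 hgj using hbin
  let F : ι → C → ι ⊕ C × ℕ := fun t c =>
    if a ≤ n t c then Sum.inl t
    else if (job t c).2 = 0 then Sum.inr (c, 0)
    else if job t c ∈ Rem then Sum.inr (c, g c (job t c))
    else Sum.inl (f (job t c))
  have hF1 : ∀ {t c}, a ≤ n t c → F t c = Sum.inl t := fun h1 => if_pos h1
  have hF2 : ∀ {t c}, ¬ a ≤ n t c → (job t c).2 = 0 → F t c = Sum.inr (c, 0) := fun h1 h2 => by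
    simp only [F, if_neg h1, if_pos h2]
  have hF3 : ∀ {t c}, ¬ a ≤ n t c → (job t c).2 ≠ 0 → job t c ∈ Rem →
      F t c = Sum.inr (c, g c (job t c)) := fun h1 h2 h3 => by
    simp only [F, if_neg h1, if_neg h2, if_pos h3]
  have hF4 : ∀ {t c}, ¬ a ≤ n t c → (job t c).2 ≠ 0 → job t c ∉ Rem →
      F t c = Sum.inl (f (job t c)) := fun h1 h2 h3 => by
    simp only [F, if_neg h1, if_neg h2, if_neg h3]
  -- A portion is dominated by the indicator of its job.
  have hsingle : ∀ (D : Finset ((_ : C × Bool) × ℕ)) t c, ¬ a ≤ n t c → job t c ∈ D →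
      n t c ≤ ∑ q ∈ D, if n t c < a ∧ job t c = q then n t c else 0 := by
    intro D t c h1 h2
    simp only [not_le.mp h1, true_and, sum_ite_eq, if_pos h2, le_refl]
  have hsum0 : ∀ (D : Finset ((_ : C × Bool) × ℕ)) t c,
      0 ≤ ∑ q ∈ D, if n t c < a ∧ job t c = q then n t c else 0 := fun D t c =>
    sum_nonneg fun q _ => by
      split_ifs
      · exact hn t c
      · exact le_rfl
  refine ⟨F, m, ?_, ?_, ?_, ?_, ?_, ?_⟩
  · intro t c t' hpos hFt
    by_cases h1 : a ≤ n t c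
    · rw [hF1 h1] at hFt
      cases hFt
      exact ⟨hpos, id⟩
    by_cases h2 : (job t c).2 = 0
    · rw [hF2 h1 h2] at hFt; cases hFt
    by_cases h3 : job t c ∈ Rem
    · rw [hF3 h1 h2 h3] at hFt; cases hFt
    rw [hF4 h1 h2 h3] at hFt
    cases hFt
    have h4 := (hf _ (hjobB t c h2)).2
    rw [hw1, hjobc] at h4
    split_ifs at h4 with h5
    · refine ⟨h4, fun hp => ?_⟩
      have h6 : decide (pass (f (job t c)) c) = decide (pass t c) :=
        congrArg (fun q => q.1.2) h5.2
      rwa [decide_eq_decide.mp h6]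
    · exact absurd h4 (lt_irrefl _)
  · intro t c c' j hFt
    by_cases h1 : a ≤ n t c
    · rw [hF1 h1] at hFt; cases hFt
    by_cases h2 : (job t c).2 = 0
    · rw [hF2 h1 h2] at hFt
      cases hFt
      exact ⟨rfl, Nat.zero_le _⟩
    by_cases h3 : job t c ∈ Rem
    · rw [hF3 h1 h2 h3] at hFt
      cases hFt
      exact ⟨rfl, hgm _ _⟩
    · rw [hF4 h1 h2 h3] at hFt; cases hFt
  · intro t'
    refine le_trans ?_ (hRk t')
    have h1 : ∀ D : Finset ((_ : C × Bool) × ℕ), ∑ q ∈ D, s q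
        = ∑ t, ∑ c, ∑ q ∈ D, if n t c < a ∧ job t c = q then n t c else 0 := by
      intro D
      simp only [s, w]
      rw [sum_comm]
      exact sum_congr rfl fun t _ => sum_comm
    have h2 : big t' = ∑ t, ∑ c, if t = t' ∧ a ≤ n t c then n t c else 0 := by
      rw [sum_eq_single_of_mem t' (mem_univ _) fun t _ ht => sum_eq_zero fun c _ =>
        if_neg fun h => ht h.1]
      simp [big]
    rw [h1, h2, ← sum_add_distrib]
    refine sum_le_sum fun t _ => ?_
    rw [← sum_add_distrib]
    refine sum_le_sum fun c _ => ?_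
    have h4 := hsum0 (D t') t c
    have h5 : (0 : ℝ) ≤ if t = t' ∧ a ≤ n t c then n t c else 0 := by
      split_ifs
      · exact hn t c
      · exact le_rfl
    by_cases h3 : F t c = Sum.inl t'
    · rw [if_pos h3]
      by_cases h6 : a ≤ n t c
      · rw [hF1 h6] at h3
        cases h3
        rw [if_pos ⟨rfl, h6⟩]
        linarith
      by_cases h7 : (job t c).2 = 0
      · rw [hF2 h6 h7] at h3; cases h3
      by_cases h8 : job t c ∈ Rem
      · rw [hF3 h6 h7 h8] at h3; cases h3
      · rw [hF4 h6 h7 h8] at h3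
        cases h3
        have h9 := hjobB t c h7
        have := hsingle (D (f (job t c))) t c h6
          ((hD _ _).mpr ⟨mem_filter.mpr ⟨h9, rfl⟩, fun h => h8 (mem_filter.mpr ⟨h9, h⟩)⟩)
        linarith
    · rw [if_neg h3]
      linarith
  · intro c j
    have h1 : ∀ D : Finset ((_ : C × Bool) × ℕ),
        ∑ t, ∑ q ∈ D, (if n t c < a ∧ job t c = q then n t c else 0) ≤ ∑ q ∈ D, s q := by
      intro D
      rw [sum_comm]
      refine sum_le_sum fun q _ => sum_le_sum fun t _ => ?_
      refine single_le_sum (f := fun c => if n t c < a ∧ job t c = q then n t c else 0)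
        (fun c _ => ?_) (mem_univ c)
      split_ifs
      · exact hn t c
      · exact le_rfl
    have hmem : ∀ t, job t c ∈ Rem → job t c ∈ ({q ∈ Rem | q.1.1 = c} : Finset _) :=
      fun t ht => mem_filter.mpr ⟨ht, rfl⟩
    rcases Nat.eq_zero_or_pos j with rfl | hj
    · have h2 : ∑ t, (if n t c < a ∧ (job t c).2 = 0 then n t c else 0) < 2 * a := by
        have h3 : ∑ t, (if n t c < a ∧ (job t c).2 = 0 then n t c else 0)
            = ∑ b : Bool, s ⟨(c, b), 0⟩ := by
          simp only [s]
          rw [sum_comm]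
          refine sum_congr rfl fun t _ => ?_
          rw [Fintype.sum_bool, hw1, hw1]
          by_cases h4 : n t c < a <;> by_cases h5 : pass t c <;>
            simp [job, h4, h5]
        rw [h3, Fintype.sum_bool, hs, hs]
        linarith [hz₁ (c, true), hz₁ (c, false)]
      have h3 := h1 {q ∈ ({q ∈ Rem | q.1.1 = c} : Finset _) | g c q = 0}
      have h4 : ∑ t, (if F t c = Sum.inr (c, 0) then n t c else 0) ≤
          ∑ t, (if n t c < a ∧ (job t c).2 = 0 then n t c else 0) +
          ∑ t, ∑ q ∈ {q ∈ ({q ∈ Rem | q.1.1 = c} : Finset _) | g c q = 0},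
            (if n t c < a ∧ job t c = q then n t c else 0) := by
        rw [← sum_add_distrib]
        refine sum_le_sum fun t _ => ?_
        have h5 := hsum0 {q ∈ ({q ∈ Rem | q.1.1 = c} : Finset _) | g c q = 0} t c
        by_cases h6 : a ≤ n t c
        · rw [hF1 h6, if_neg (by simp), if_neg fun h => absurd h.1 (not_lt.mpr h6)]
          linarith
        by_cases h7 : (job t c).2 = 0
        · rw [hF2 h6 h7, if_pos rfl, if_pos ⟨not_le.mp h6, h7⟩]
          linarith
        rw [if_neg (c := n t c < a ∧ _) fun h => h7 h.2, zero_add]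
        by_cases h8 : job t c ∈ Rem
        · rw [hF3 h6 h7 h8]
          split_ifs with h9
          · exact hsingle _ t c h6 (mem_filter.mpr ⟨hmem t h8, by simpa using h9⟩)
          · exact h5
        · rw [hF4 h6 h7 h8, if_neg (by simp)]
          exact h5
      linarith [hg0 c]
    · have h4 : ∑ t, (if F t c = Sum.inr (c, j) then n t c else 0) ≤
          ∑ t, ∑ q ∈ {q ∈ ({q ∈ Rem | q.1.1 = c} : Finset _) | g c q = j},
            (if n t c < a ∧ job t c = q then n t c else 0) := by
        refine sum_le_sum fun t _ => ?_
        split_ifs with h9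
        · by_cases h6 : a ≤ n t c
          · rw [hF1 h6] at h9; cases h9
          by_cases h7 : (job t c).2 = 0
          · rw [hF2 h6 h7] at h9
            cases h9
            exact absurd hj (lt_irrefl _)
          by_cases h8 : job t c ∈ Rem
          · rw [hF3 h6 h7 h8] at h9
            exact hsingle _ t c h6 (mem_filter.mpr ⟨hmem t h8, by simpa using h9⟩)
          · rw [hF4 h6 h7 h8] at h9; cases h9
        · exact hsum0 _ t c
      have h3 := h1 {q ∈ ({q ∈ Rem | q.1.1 = c} : Finset _) | g c q = j}
      by_cases hjm : j ≤ m c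
      · linarith [(hgj c j hj hjm).2]
      · have h5 : ({q ∈ ({q ∈ Rem | q.1.1 = c} : Finset _) | g c q = j} : Finset _) = ∅ :=
          filter_eq_empty_iff.mpr fun q _ h5 => hjm (h5.symm.le.trans (hgm c q))
        rw [h5, sum_empty] at h3
        rw [h5] at h4
        linarith
  · intro t c hpos hne
    have hterm : ∀ t', (0 : ℝ) ≤ if F t' c = F t c then n t' c else 0 := fun t' => by
      split_ifs
      · exact hn t' c
      · exact le_rfl
    by_cases h1 : a ≤ n t c
    · refine le_trans ?_ (single_le_sum (fun t' _ => hterm t') (mem_univ t))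
      simpa using h1
    have h2 : (job t c).2 ≠ 0 := fun h2 => hne (hF2 h1 h2)
    refine (hsa _ (hjobB t c h2)).trans (sum_le_sum fun t' _ => ?_)
    rw [hw1, hjobc]
    split_ifs with h3 h4
    · exact le_rfl
    · refine absurd ?_ h4
      have h5 := not_le.mpr h3.1
      by_cases h6 : job t c ∈ Rem
      · rw [hF3 h1 h2 h6, hF3 h5 (by rwa [h3.2]) (by rwa [h3.2]), h3.2]
      · rw [hF4 h1 h2 h6, hF4 h5 (by rwa [h3.2]) (by rwa [h3.2]), h3.2]
    · exact hn t' c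
    · exact le_rfl
  · have h1 : ∀ c, (m c : ℝ) * (k / 2) ≤ ∑ q ∈ Rem with q.1.1 = c, s q := by
      intro c
      have h2 : #(Icc 1 (m c)) • (k / 2)
          ≤ ∑ j ∈ Icc 1 (m c), ∑ q ∈ {q ∈ ({q ∈ Rem | q.1.1 = c} : Finset _) | g c q = j}, s q :=
        card_nsmul_le_sum _ _ _ fun j hj =>
          (hgj c j (mem_Icc.mp hj).1 (mem_Icc.mp hj).2).1
      rw [Nat.card_Icc, nsmul_eq_mul, Nat.add_sub_cancel] at h2
      refine h2.trans ?_
      rw [← sum_fiberwise_of_maps_to (t := range (m c + 1)) (g := g c)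
        fun q _ => mem_range.mpr (Nat.lt_succ_of_le (hgm c q))]
      refine sum_le_sum_of_subset_of_nonneg (fun j hj => ?_) fun j _ _ =>
        sum_nonneg fun q _ => hs0 q
      have := mem_Icc.mp hj
      exact mem_range.mpr (by omega)
    have h2 : (∑ c, (m c : ℝ)) * (k / 2) ≤ ∑ q ∈ Rem, s q := by
      rw [sum_mul, ← sum_fiberwise Rem fun q => q.1.1]
      exact sum_le_sum fun c _ => h1 c
    nlinarith

/-! ### Components and their spines -/

section Subgraphs

variable {T : RootedTree} {c : (graph T).Subgraph} {r : T}

lemma mem_of_connected (hc : c.Connected) {s : Set T} {a x : T} (ha : a ∈ c.verts) (has : a ∈ s)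
    (hs : ∀ u y, c.Adj u y → u ∈ s → y ∈ s) (hx : x ∈ c.verts) : x ∈ s := by
  have h := hc.preconnected.coe ⟨a, ha⟩ ⟨x, hx⟩
  obtain ⟨p⟩ := h
  have key : ∀ (u y : c.verts) (_ : c.coe.Walk u y), u.1 ∈ s → y.1 ∈ s := by
    intro u y p
    induction p with
    | nil => exact id
    | cons h p ih => exact fun hu => ih (hs _ _ h hu)
  exact key _ _ p has

lemma exists_isRootOf [Fintype T] (hc : c.Connected) : ∃ r, IsRootOf c r := by
  obtain ⟨a, ha⟩ := hc.nonempty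
  obtain ⟨r, _, hr⟩ := Finite.exists_le_minimal (p := fun x => x ∈ c.verts) ha
  refine ⟨r, hr.prop, fun x hx => ?_⟩
  refine mem_of_connected hc (s := {x | r ≤ x}) hr.prop (le_refl r) (fun u y huy hu => ?_) hx
  by_contra hy
  obtain ⟨rfl, rfl, h0⟩ := eq_of_adj_of_le huy.adj_sub.symm hy hu
  exact hy (hr.le_of_le huy.snd_mem (pred_lt h0).le)

lemma IsRootOf.unique {r' : T} (hr : IsRootOf c r) (hr' : IsRootOf c r') : r = r' :=
  IsLeast.unique hr hr'

/-- A connected subgraph contains the edge from each of its vertices to the parent, unless the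
vertex is its root. -/
lemma pred_edge_mem (hc : c.Connected) (hr : IsRootOf c r) {v : T} (hv : v ∈ c.verts)
    (hne : v ≠ r) : s(Order.pred v, v) ∈ c.edgeSet := by
  by_contra h
  refine hne (le_antisymm ?_ (hr.2 hv))
  refine mem_of_connected hc (s := {x | v ≤ x}) hv (le_refl v) (fun u y huy hu => ?_) hr.1
  by_contra hy
  obtain ⟨rfl, rfl, -⟩ := eq_of_adj_of_le huy.adj_sub.symm hy hu
  exact h huy.symm

lemma lt_of_pred_edge_mem (hr : IsRootOf c r) {v : T} (hv : v ≠ ⊥)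
    (h : s(Order.pred v, v) ∈ c.edgeSet) : r < v :=
  (hr.2 (SimpleGraph.Subgraph.mem_edgeSet.mp h).fst_mem).trans_lt (pred_lt hv)

lemma mem_of_pred_edge_mem {v : T} (h : s(Order.pred v, v) ∈ c.edgeSet) : v ∈ c.verts :=
  (SimpleGraph.Subgraph.mem_edgeSet.mp h).snd_mem

lemma not_isMax_root (hc : c.edgeSet.Nonempty) (hr : IsRootOf c r) : ¬ IsMax r := by
  obtain ⟨e, he⟩ := hc
  obtain ⟨v, hv, rfl⟩ := exists_edge (c.edgeSet_subset he)
  exact fun h => h.not_lt (lt_of_pred_edge_mem hr hv he)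

lemma mem_of_le_of_le [Fintype T] (hc : c.Connected) (hr : IsRootOf c r) {u x : T}
    (hx : x ∈ c.verts) (hru : r ≤ u) (hux : u ≤ x) : u ∈ c.verts := by
  obtain ⟨y, -, hy⟩ := Finite.exists_le_minimal (p := fun y => y ∈ c.verts ∧ u ≤ y) ⟨hx, hux⟩
  rcases hy.prop.2.eq_or_lt with h | h
  · rw [h]; exact hy.prop.1
  · have h1 := pred_edge_mem hc hr hy.prop.1 (hru.trans_lt h).ne'
    have h2 := (SimpleGraph.Subgraph.mem_edgeSet.mp h1).fst_mem
    have h3 := hy.le_of_le ⟨h2, Order.le_pred_of_lt h⟩ (Order.pred_le y)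
    exact absurd h3 (pred_lt (bot_le.trans_lt h).ne').not_ge

lemma IsExitOf.unique {𝒞 : Finset (graph T).Subgraph} {e e' : T} (h : IsExitOf 𝒞 c e)
    (h' : IsExitOf 𝒞 c e') : e = e' := by
  obtain ⟨c', hc', hne, hmem⟩ := h.2.2.1
  exact (h'.2.2.2 c' hc' hne e h.1 hmem).resolve_left h.2.1

end Subgraphs

section Decompositions

variable {T : RootedTree} [Fintype T] {ε : ℝ} {k : ℕ} {𝒞 : Finset (graph T).Subgraph}

lemma exists_child_le {u x : T} (h : u < x) : ∃ y, u ⋖ y ∧ y ≤ x := by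
  obtain ⟨y, -, hy⟩ := Finite.exists_le_minimal (p := fun y => u < y ∧ y ≤ x) ⟨h, le_rfl⟩
  refine ⟨y, ⟨hy.prop.1, fun z hz hzy => ?_⟩, hy.prop.2⟩
  exact hzy.not_ge (hy.le_of_le ⟨hz, hzy.le.trans hy.prop.2⟩ hzy.le)

namespace IsDecomposition

lemma exists_comp (hD : IsDecomposition ε k 𝒞) {v : T} (hv : v ≠ ⊥) :
    ∃ c ∈ 𝒞, s(Order.pred v, v) ∈ c.edgeSet := by
  obtain ⟨c, hc, -⟩ := hD.edge_partition _ ((SimpleGraph.mem_edgeSet _).mpr (pred_adj hv))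
  exact ⟨c, hc⟩

lemma comp_unique (hD : IsDecomposition ε k 𝒞) {v : T} (hv : v ≠ ⊥) {c c' : (graph T).Subgraph}
    (hc : c ∈ 𝒞) (h : s(Order.pred v, v) ∈ c.edgeSet) (hc' : c' ∈ 𝒞)
    (h' : s(Order.pred v, v) ∈ c'.edgeSet) : c = c' :=
  (hD.edge_partition _ ((SimpleGraph.mem_edgeSet _).mpr (pred_adj hv))).unique ⟨hc, h⟩ ⟨hc', h'⟩

lemma terminal_mem_iff (hD : IsDecomposition ε k 𝒞) {c : (graph T).Subgraph} (hc : c ∈ 𝒞)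
    (x : Terminal T) : x.1 ∈ c.verts ↔ s(Order.pred x.1, x.1) ∈ c.edgeSet := by
  refine ⟨fun hx => ?_, mem_of_pred_edge_mem⟩
  obtain ⟨r, hr⟩ := exists_isRootOf (hD.connected c hc)
  refine pred_edge_mem (hD.connected c hc) hr hx fun h => ?_
  exact not_isMax_root (hD.edges_nonempty c hc) hr (h ▸ x.2)

/-- The path from an edge of `c` down to an edge of another component `c'` leaves `c` at the exit
vertex of `c`, which lies above all of `c'`. -/
lemma exists_exit_between (hD : IsDecomposition ε k 𝒞) {v x : T} (hv : v ≠ ⊥) (hvx : v ≤ x)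
    {c c' : (graph T).Subgraph} (hc : c ∈ 𝒞) (h : s(Order.pred v, v) ∈ c.edgeSet) (hc' : c' ∈ 𝒞)
    (h' : s(Order.pred x, x) ∈ c'.edgeSet) (hne : c ≠ c') {r' : T} (hr' : IsRootOf c' r') :
    ¬ IsLeafComp c ∧ ∃ e, IsExitOf 𝒞 c e ∧ v ≤ e ∧ e ≤ r' := by
  obtain ⟨r, hr⟩ := exists_isRootOf (hD.connected c hc)
  have hrv := lt_of_pred_edge_mem hr hv h
  have hx : x ≠ ⊥ := fun h0 => hv (le_bot_iff.mp (h0 ▸ hvx))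
  obtain ⟨u, hvu, hu⟩ := Finite.exists_le_maximal (p := fun u => u ≤ x ∧ u ∈ c.verts)
    ⟨hvx, mem_of_pred_edge_mem h⟩
  have hru := hrv.trans_le hvu
  have huc := pred_edge_mem (hD.connected c hc) hr hu.prop.2 hru.ne'
  have hu0 : u ≠ ⊥ := (bot_le.trans_lt hru).ne'
  have hux : u < x := lt_of_le_of_ne hu.prop.1 fun hux => by
    subst hux
    exact hne (hD.comp_unique hx hc huc hc' h')
  obtain ⟨y, huy, hyx⟩ := exists_child_le hux
  have hy0 : y ≠ ⊥ := (bot_le.trans_lt huy.lt).ne'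
  obtain ⟨d, hd, hyd⟩ := hD.exists_comp hy0
  have hdc : d ≠ c := by
    rintro rfl
    exact huy.lt.not_ge (hu.le_of_ge ⟨hyx, mem_of_pred_edge_mem hyd⟩ huy.lt.le)
  have hud : u ∈ d.verts := by
    have := (SimpleGraph.Subgraph.mem_edgeSet.mp hyd).fst_mem
    rwa [huy.pred_eq] at this
  have hur : ¬ IsRootOf c u := fun h1 => hru.ne (hr.unique h1)
  have hleaf : ¬ IsLeafComp c := fun hl => hur (hD.leaf_meets c hc hl d hd hdc u hu.prop.2 hud)
  refine ⟨hleaf, ?_⟩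
  obtain ⟨e, he⟩ := hD.internal_exit c hc hleaf
  obtain rfl : u = e := (he.2.2.2 d hd hdc u hu.prop.2 hud).resolve_left hur
  refine ⟨u, he, hvu, ?_⟩
  have hxc' := mem_of_pred_edge_mem h'
  by_contra hur'
  have hru' : r' < u := by
    rcases le_or_le_of_le hu.prop.1 (hr'.2 hxc') with h1 | h1
    · exact absurd h1 hur'
    · exact lt_of_le_of_ne h1 fun h2 => hur' h2.ge
  have h1 := mem_of_le_of_le (hD.connected c' hc') hr' hxc' hru'.le hu.prop.1
  exact hne (hD.comp_unique hu0 hc huc hc' (pred_edge_mem (hD.connected c' hc') hr' h1 hru'.ne'))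

/-- Below the exit vertex of a component there is a big component. -/
lemma le_card_above_exit (hD : IsDecomposition ε k 𝒞) {c : (graph T).Subgraph} (hc : c ∈ 𝒞) {e : T}
    (he : IsExitOf 𝒞 c e) : Gam ε * k ≤ count (fun x : Terminal T => e ≤ x.1) := by
  obtain ⟨c', hc', hne, hec'⟩ := he.2.2.1
  obtain ⟨r, hr⟩ := exists_isRootOf (hD.connected c hc)
  have her : e ≠ r := fun h => he.2.1 (h ▸ hr)
  have hedge := pred_edge_mem (hD.connected c hc) hr he.1 her
  have hle : ∀ u ∈ c'.verts, e ≤ u := fun u hu => by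
    refine mem_of_connected (hD.connected c' hc') (s := {x | e ≤ x}) hec' (le_refl e)
      (fun u y huy hu => ?_) hu
    by_contra hy
    obtain ⟨rfl, rfl, h0⟩ := eq_of_adj_of_le huy.adj_sub.symm hy hu
    exact hne (hD.comp_unique h0 hc' huy.symm hc hedge)
  obtain ⟨f, hf, -⟩ := hD.map_to_big (Finset.one_lt_card.mpr ⟨c, hc, c', hc', hne.symm⟩)
  obtain ⟨hbig, hdesc⟩ := hf ⟨c', hc'⟩
  refine hbig.trans (Nat.cast_le.mpr (count_mono fun x hx => ?_))
  rcases hdesc with h | ⟨v, hv, -, h⟩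
  · rw [h] at hx
    exact hle _ hx
  · exact (hle v hv).trans (h _ hx)

end IsDecomposition

/-- The data extracted from a decomposition `𝒞`: the component `comp v` that contains the edge from
`v` to its parent, the root vertex of each component, and the anchor of each component, which is the
exit vertex of an internal component and the root vertex of a leaf component. The vertices between
the root vertex and the anchor form the spine of the component. -/
structure IsSkeleton (I : Inst T) (ε : ℝ) (comp : T → 𝒞) (root anchor : 𝒞 → T) : Prop where
  root_mem : ∀ c, root c ∈ c.1.verts
  root_le : ∀ c, ∀ v ∈ c.1.verts, root c ≤ v
  root_internal : ∀ c, ¬ IsMax (root c)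
  terminal_mem : ∀ (c : 𝒞) (x : Terminal T), x.1 ∈ c.1.verts ↔ comp x.1 = c
  root_le_anchor : ∀ c, root c ≤ anchor c
  between : ∀ (v : T) (x : Terminal T), v ≠ ⊥ → v ≤ x.1 → comp v ≠ comp x.1 →
    v ≤ anchor (comp v) ∧ anchor (comp v) ≤ root (comp x.1)
  spine : ∀ c v, root c < v → v ≤ anchor c →
    comp v = c ∧ Gam ε * I.cap ≤ count (fun x : Terminal T => v ≤ x.1)
  sum_root : (∑ c, I.depotDist (root c)) * (Gam ε * I.cap) ≤ 3 * ∑ x : Terminal T, I.depotDist x.1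

open Finset in
open scoped Classical in
/-- Each component is charged to the terminals of its big image, which lie below its root vertex;
every terminal is charged at most three times. -/
lemma IsDecomposition.sum_root_le (I : Inst T) (hD : IsDecomposition ε I.cap 𝒞) {root : 𝒞 → T}
    (hroot : ∀ c : 𝒞, IsRootOf c.1 (root c)) (hT : ∀ x : Terminal T, x.1 ≠ ⊥) :
    (∑ c, I.depotDist (root c)) * (Gam ε * I.cap) ≤ 3 * ∑ x : Terminal T, I.depotDist x.1 := by
  have hnn : 0 ≤ ∑ x : Terminal T, I.depotDist x.1 := sum_nonneg fun x _ => I.depotDist_nonneg _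
  by_cases hcard : 1 < 𝒞.card
  · obtain ⟨f, hf, hf3⟩ := hD.map_to_big hcard
    have h1 : ∀ c : 𝒞, I.depotDist (root c) * (Gam ε * I.cap)
        ≤ ∑ x : Terminal T, if x.1 ∈ (f c).1.verts then I.depotDist x.1 else 0 := by
      intro c
      obtain ⟨hbig, hdesc⟩ := hf c
      refine (mul_le_mul_of_nonneg_left hbig (I.depotDist_nonneg _)).trans ?_
      rw [numTerminals, count_eq_card, ← sum_filter, mul_comm, ← nsmul_eq_mul]
      refine card_nsmul_le_sum _ _ _ fun x hx => I.depotDist_mono ?_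
      have hx' := (mem_filter.mp hx).2
      rcases hdesc with h | ⟨v, hv, -, h⟩
      · exact (hroot c).2 (h ▸ hx')
      · exact ((hroot c).2 hv).trans (h _ hx')
    rw [sum_mul]
    refine (sum_le_sum fun c _ => h1 c).trans ?_
    rw [sum_comm, mul_sum]
    refine sum_le_sum fun x _ => ?_
    obtain ⟨b, hb, hxb⟩ := hD.exists_comp (hT x)
    have h2 : ∀ c : 𝒞, x.1 ∈ (f c).1.verts → f c = ⟨b, hb⟩ := fun c hx =>
      Subtype.ext (hD.comp_unique (hT x) (f c).2 ((hD.terminal_mem_iff (f c).2 x).mp hx) hb hxb)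
    rw [← sum_filter, sum_const, nsmul_eq_mul]
    refine mul_le_mul_of_nonneg_right ?_ (I.depotDist_nonneg _)
    have h3 := hf3 ⟨b, hb⟩
    rw [count_eq_card] at h3
    have h4 : #{c : 𝒞 | x.1 ∈ (f c).1.verts} ≤ 3 :=
      (card_le_card (monotone_filter_right _ fun c _ => h2 c)).trans h3
    exact_mod_cast h4
  · -- With a single component, its root vertex is the depot.
    have h1 : ∀ c : 𝒞, root c = ⊥ := by
      intro c
      by_contra h
      obtain ⟨c', hc', hcc'⟩ := hD.exists_comp h
      have : c' = c.1 := by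
        by_contra hne
        exact hcard (one_lt_card.mpr ⟨c', hc', c.1, c.2, hne⟩)
      rw [this] at hcc'
      exact lt_irrefl _ (lt_of_pred_edge_mem (hroot c) h hcc')
    rw [sum_eq_zero fun c _ => by rw [h1, I.depotDist_bot]]
    linarith

open scoped Classical in
lemma IsDecomposition.exists_skeleton (I : Inst T) (hD : IsDecomposition ε I.cap 𝒞)
    (hT : ∀ x : Terminal T, x.1 ≠ ⊥) :
    ∃ (comp : T → 𝒞) (root anchor : 𝒞 → T), IsSkeleton I ε comp root anchor := by
  choose root hroot using fun c : 𝒞 => exists_isRootOf (hD.connected c.1 c.2)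
  have hcomp : ∀ v : T, ∃ c : 𝒞, v ≠ ⊥ → s(Order.pred v, v) ∈ c.1.edgeSet := by
    intro v
    by_cases hv : v = ⊥
    · obtain ⟨x, -⟩ := exists_terminal_ge (⊥ : T)
      obtain ⟨c, hc, -⟩ := hD.exists_comp (hT x)
      exact ⟨⟨c, hc⟩, fun h => absurd hv h⟩
    · obtain ⟨c, hc, h⟩ := hD.exists_comp hv
      exact ⟨⟨c, hc⟩, fun _ => h⟩
  choose comp hcomp using hcomp
  have hcomp_eq : ∀ {v : T} {c : 𝒞}, v ≠ ⊥ → s(Order.pred v, v) ∈ c.1.edgeSet → comp v = c :=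
    fun {v c} h0 h => Subtype.ext (hD.comp_unique h0 (comp v).2 (hcomp v h0) c.2 h)
  have hanchor : ∀ c : 𝒞, ∃ a,
      (IsLeafComp c.1 → a = root c) ∧ (¬ IsLeafComp c.1 → IsExitOf 𝒞 c.1 a) := by
    intro c
    by_cases hl : IsLeafComp c.1
    · exact ⟨root c, fun _ => rfl, fun h => absurd hl h⟩
    · obtain ⟨e, he⟩ := hD.internal_exit c.1 c.2 hl
      exact ⟨e, fun h => absurd h hl, fun _ => he⟩
  choose anchor hleaf hexit using hanchor
  refine ⟨comp, root, anchor, fun c => (hroot c).1, fun c v hv => (hroot c).2 hv,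
    fun c => not_isMax_root (hD.edges_nonempty c.1 c.2) (hroot c), fun c x => ?_, fun c => ?_,
    fun v x hv hvx hne => ?_, fun c v hrv hva => ?_, hD.sum_root_le I hroot hT⟩
  · rw [hD.terminal_mem_iff c.2]
    exact ⟨hcomp_eq (hT x), fun h => h ▸ hcomp _ (hT x)⟩
  · by_cases hl : IsLeafComp c.1
    · exact (hleaf c hl).ge
    · exact (hroot c).2 (hexit c hl).1
  · obtain ⟨hl, e, he, h1, h2⟩ := hD.exists_exit_between hv hvx (comp v).2 (hcomp v hv)
      (comp x.1).2 (hcomp _ (hT x)) (fun h => hne (Subtype.ext h)) (hroot _)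
    rw [(hexit _ hl).unique he]
    exact ⟨h1, h2⟩
  · have hl : ¬ IsLeafComp c.1 := fun hl => (hrv.trans_le hva).ne (hleaf c hl).symm
    have he := hexit c hl
    have hv := mem_of_le_of_le (hD.connected c.1 c.2) (hroot c) he.1 hrv.le hva
    refine ⟨hcomp_eq (bot_le.trans_lt hrv).ne'
      (pred_edge_mem (hD.connected c.1 c.2) (hroot c) hv hrv.ne'), ?_⟩
    exact (hD.le_card_above_exit c.2 he).trans
      (Nat.cast_le.mpr (count_mono fun x hx => hva.trans hx))

end Decompositions

/-! ### The cost of a repacking -/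

section Count

open Finset

open scoped Classical in
lemma count_sumType {α β : Type*} [Fintype α] [Fintype β] (p : α ⊕ β → Prop) :
    count p = count (fun a => p (Sum.inl a)) + count (fun b => p (Sum.inr b)) := by
  simp only [count_eq_card, card_filter, Fintype.sum_sum_type]

lemma count_pos_iff {α : Type*} [Fintype α] {p : α → Prop} : 0 < count p ↔ ∃ a, p a := by
  classical
  rw [count_eq_card, card_pos]
  simp [Finset.Nonempty]

open scoped Classical in
lemma count_eq_sum_portions {X ι C : Type*} [Fintype X] [Fintype ι] [Fintype C] (g : X → ι)
    (comp : X → C) (P : ι → C → Prop) :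
    (count (fun x => P (g x) (comp x)) : ℝ) =
      ∑ t, ∑ c, if P t c then (count (fun x => g x = t ∧ comp x = c) : ℝ) else 0 := by
  rw [count_eq_card, card_eq_sum_card_fiberwise (f := fun x => (g x, comp x)) (t := univ)
    fun x _ => mem_univ _, Fintype.sum_prod_type]
  push_cast
  refine sum_congr rfl fun t _ => sum_congr rfl fun c _ => ?_
  rw [filter_filter, count_eq_card]
  split_ifs with h
  · congr 2
    ext x
    simp only [mem_filter, mem_univ, true_and, Prod.mk.injEq]
    constructor
    · exact fun h => h.2
    · rintro ⟨rfl, rfl⟩; exact ⟨h, rfl, rfl⟩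
  · rw [Nat.cast_eq_zero, card_eq_zero, filter_eq_empty_iff]
    rintro x - ⟨h1, h2⟩
    simp only [Prod.mk.injEq] at h2
    exact h (h2.1 ▸ h2.2 ▸ h1)

lemma sum_count_le {X J : Type*} [Fintype X] (Q : Finset J) (p : J → X → Prop) (q : X → Prop)
    (hpq : ∀ i x, p i x → q x) (hdisj : ∀ i i' x, p i x → p i' x → i = i') :
    ∑ i ∈ Q, count (p i) ≤ count q := by
  classical
  simp only [count_eq_card]
  rw [← card_biUnion]
  · refine card_le_card fun x hx => ?_
    simp only [mem_biUnion, mem_filter, mem_univ, true_and] at hx ⊢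
    obtain ⟨i, -, hi⟩ := hx
    exact hpq i x hi
  · refine fun i _ i' _ hne => disjoint_left.mpr fun x hx hx' => hne ?_
    exact hdisj i i' x (mem_filter.mp hx).2 (mem_filter.mp hx').2

end Count

section Costs

open Finset

variable {T : RootedTree} [Fintype T] {ε : ℝ} {𝒞 : Finset (graph T).Subgraph} {I : Inst T}
  {comp : T → 𝒞} {root anchor : 𝒞 → T}

open scoped Classical in
/-- Repacking portions does not increase the number of tours that enter the subtree of `v`, up to
the new tours of the components whose spine, or the path from the depot to it, runs through `v`.

To every other tour below `v` belongs an old one: a tour that passes the component `c` of `v` along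
the spine is its own partner, and any other tour has a portion of `c` below `v`, which it took from
an old tour. -/
lemma IsSkeleton.numHits_le (hs : IsSkeleton I ε comp root anchor) {ι : Type*} [Nonempty ι]
    (g : Terminal T → ι) (F : ι → 𝒞 → ι ⊕ 𝒞 × ℕ) (m : 𝒞 → ℕ)
    (hF : ∀ (x : Terminal T) t', F (g x) (comp x.1) = Sum.inl t' →
      (∃ y : Terminal T, g y = t' ∧ comp y.1 = comp x.1) ∧
      ((∃ y : Terminal T, g y = g x ∧ anchor (comp x.1) ≤ y.1) →
        ∃ y : Terminal T, g y = t' ∧ anchor (comp x.1) ≤ y.1))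
    (hF' : ∀ t c c' j, F t c = Sum.inr (c', j) → c' = c ∧ j ≤ m c) {v : T} (hv : v ≠ ⊥) :
    numHits (fun x : Terminal T => x.1) (fun x => F (g x) (comp x.1)) v ≤
      numHits (fun x : Terminal T => x.1) g v + ∑ c with v ≤ anchor c, (m c + 1) := by
  set A : Set (ι ⊕ 𝒞 × ℕ) := (fun x : Terminal T => F (g x) (comp x.1)) '' {x | v ≤ x.1}
  let E : Finset (ι ⊕ 𝒞 × ℕ) := ({c | v ≤ anchor c} : Finset 𝒞).biUnion fun c =>
    (range (m c + 1)).image fun j => Sum.inr (c, j)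
  have hE : ∀ c j, v ≤ anchor c → j ≤ m c → (Sum.inr (c, j) : ι ⊕ 𝒞 × ℕ) ∈ E := fun c j h1 h2 =>
    mem_biUnion.mpr ⟨c, by simpa using h1, mem_image.mpr ⟨j, mem_range.mpr (by omega), rfl⟩⟩
  have hEcard : #E ≤ ∑ c with v ≤ anchor c, (m c + 1) := by
    refine card_biUnion_le.trans (sum_le_sum fun c _ => card_image_le.trans ?_)
    rw [card_range]
  have hA : A.Finite := Set.toFinite _
  have h1 : A.ncard ≤ (A \ E).ncard + #E := by
    rw [← Set.ncard_coe_finset E]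
    refine (Set.ncard_le_ncard (t := A \ E ∪ E) (by simp) ?_).trans (Set.ncard_union_le _ _)
    exact (hA.subset Set.sdiff_subset).union (finite_toSet E)
  -- `s` is an old tour that passes the component of `v` along its spine, through `v`
  let passes : ι ⊕ 𝒞 × ℕ → ι → Prop := fun s t => s = Sum.inl t ∧ v ≤ anchor (comp v) ∧
    ∃ y : Terminal T, g y = t ∧ anchor (comp v) ≤ y.1
  have h2 : ∀ s, ∃ t, s ∈ A \ E → t ∈ g '' {x | v ≤ x.1} ∧ (passes s t ∨ (¬ (∃ t', passes s t') ∧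
      ∃ x : Terminal T, g x = t ∧ comp x.1 = comp v ∧ F (g x) (comp x.1) = s)) := by
    intro s
    by_cases hsA : s ∈ A \ E
    swap
    · exact ⟨Classical.arbitrary ι, fun h => absurd h hsA⟩
    by_cases hp : ∃ t, passes s t
    · obtain ⟨t, ht⟩ := hp
      obtain ⟨-, h3, y, h4, h5⟩ := id ht
      exact ⟨t, fun _ => ⟨⟨y, h3.trans h5, h4⟩, Or.inl ht⟩⟩
    obtain ⟨⟨x, hx, hxs⟩, hsE⟩ := hsA
    simp only [Set.mem_ofPred_eq] at hx hxs
    refine ⟨g x, fun _ => ⟨⟨x, hx, rfl⟩, Or.inr ⟨hp, x, rfl, ?_, hxs⟩⟩⟩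
    by_contra hne
    obtain ⟨h3, h4⟩ := hs.between v x hv hx fun h => hne h.symm
    rcases hF1 : F (g x) (comp x.1) with t' | ⟨c', j⟩
    · obtain ⟨⟨y, hy, hyc⟩, -⟩ := hF x t' hF1
      refine hp ⟨t', hxs ▸ hF1, h3, y, hy, h4.trans ?_⟩
      exact hs.root_le _ _ ((hs.terminal_mem _ y).mpr hyc)
    · obtain ⟨rfl, hj⟩ := hF' _ _ _ _ hF1
      rw [hF1] at hxs
      subst hxs
      exact hsE (hE _ j (h3.trans (h4.trans (hs.root_le_anchor _))) hj)
  choose φ hφ using h2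
  have h3 : (A \ E).ncard ≤ (g '' {x : Terminal T | v ≤ x.1}).ncard := by
    refine Set.ncard_le_ncard_of_injOn φ (fun s hs => (hφ s hs).1) ?_ (Set.toFinite _)
    have key : ∀ s s' t, s' ∈ A \ E → passes s t → ¬ (∃ t', passes s' t') →
        ¬ ∃ x : Terminal T, g x = t ∧ comp x.1 = comp v ∧ F (g x) (comp x.1) = s' := by
      rintro s s' t hs' ⟨-, hva, hy⟩ hnp ⟨x, rfl, hxc, hxs⟩
      rcases hF1 : F (g x) (comp x.1) with t' | ⟨c', j⟩
      · have := (hF x t' hF1).2 (hxc ▸ hy)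
        rw [hxc] at this
        exact hnp ⟨t', hxs ▸ hF1, hva, this⟩
      · obtain ⟨rfl, hj⟩ := hF' _ _ _ _ hF1
        rw [hF1] at hxs
        subst hxs
        exact hs'.2 (hE _ j (hxc ▸ hva) hj)
    intro s hs s' hs' heq
    rcases (hφ s hs).2 with h4 | ⟨h4, h5⟩ <;> rcases (hφ s' hs').2 with h6 | ⟨h6, h7⟩
    · rw [h4.1, h6.1, heq]
    · rw [← heq] at h7
      exact absurd h7 (key s s' _ hs' h4 h6)
    · rw [heq] at h5
      exact absurd h5 (key s' s _ hs h6 h4)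
    · obtain ⟨x, hx, hxc, hxs⟩ := h5
      obtain ⟨y, hy, hyc, hys⟩ := h7
      rw [← hxs, ← hys, hx, hy, hxc, hyc, heq]
  exact h1.trans (add_le_add h3 hEcard)

open scoped Classical in
lemma IsSkeleton.routeCost_le (hs : IsSkeleton I ε comp root anchor) {ι : Type*} [Nonempty ι]
    (g : Terminal T → ι) (F : ι → 𝒞 → ι ⊕ 𝒞 × ℕ) (m : 𝒞 → ℕ)
    (hF : ∀ (x : Terminal T) t', F (g x) (comp x.1) = Sum.inl t' →
      (∃ y : Terminal T, g y = t' ∧ comp y.1 = comp x.1) ∧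
      ((∃ y : Terminal T, g y = g x ∧ anchor (comp x.1) ≤ y.1) →
        ∃ y : Terminal T, g y = t' ∧ anchor (comp x.1) ≤ y.1))
    (hF' : ∀ t c c' j, F t c = Sum.inr (c', j) → c' = c ∧ j ≤ m c) :
    I.routeCost (fun x : Terminal T => x.1) (fun x => F (g x) (comp x.1)) ≤
      I.routeCost (fun x : Terminal T => x.1) g +
        ∑ c, (m c + 1) * (2 * I.depotDist (anchor c)) := by
  have h1 : ∑ c, ((m c : ℝ) + 1) * (2 * I.depotDist (anchor c))
      = ∑ v, 2 * I.wt v * ∑ c with v ≤ anchor c, ((m c : ℝ) + 1) := by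
    simp only [I.depotDist_eq, mul_sum, sum_filter]
    rw [sum_comm]
    refine sum_congr rfl fun v _ => sum_congr rfl fun c _ => ?_
    split_ifs <;> ring
  rw [h1]
  unfold Inst.routeCost
  rw [← sum_add_distrib]
  refine sum_le_sum fun v _ => ?_
  by_cases hv : v = ⊥
  · simp [Inst.wt, hv]
  rw [← mul_add]
  refine mul_le_mul_of_nonneg_left ?_ (by linarith [I.wt_nonneg v])
  exact_mod_cast hs.numHits_le g F m hF hF' hv

open scoped Classical in
lemma count_le_mul_numHits {ι : Type*} [Fintype ι] (g : Terminal T → ι) {k : ℕ}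
    (hg : ∀ t, count (fun x => g x = t) ≤ k) (v : T) :
    count (fun x : Terminal T => v ≤ x.1) ≤ k * numHits (fun x : Terminal T => x.1) g v := by
  rw [count_eq_card, numHits_eq_card]
  refine card_le_mul_card_image_of_maps_to (f := g) (fun x hx => ?_) k fun t _ => ?_
  · simp only [mem_filter, mem_univ, true_and] at hx ⊢
    exact ⟨x, rfl, hx⟩
  · refine le_trans ?_ (hg t)
    rw [count_eq_card]
    refine card_le_card fun x hx => ?_
    simp only [mem_filter, mem_univ, true_and] at hx ⊢
    exact hx.2

open scoped Classical in
/-- The radial lower bound: a tour of capacity `k` pays for each of its terminals at least `2 / k`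
times the distance to the depot. -/
lemma two_mul_sum_depotDist_le {ι : Type*} [Fintype ι] (g : Terminal T → ι) {k : ℕ}
    (hg : ∀ t, count (fun x => g x = t) ≤ k) :
    2 * ∑ x : Terminal T, I.depotDist x.1 ≤ k * I.routeCost (fun x : Terminal T => x.1) g := by
  have h1 : ∑ x : Terminal T, I.depotDist x.1
      = ∑ v, I.wt v * count (fun x : Terminal T => v ≤ x.1) := by
    simp only [I.depotDist_eq, sum_filter]
    rw [sum_comm]
    refine sum_congr rfl fun v _ => ?_
    rw [← sum_filter, sum_const, nsmul_eq_mul, mul_comm, count_eq_card]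
  rw [h1, Inst.routeCost, mul_sum, mul_sum]
  refine sum_le_sum fun v _ => ?_
  have h2 : (count (fun x : Terminal T => v ≤ x.1) : ℝ)
      ≤ k * numHits (fun x : Terminal T => x.1) g v := by
    exact_mod_cast count_le_mul_numHits g hg v
  have := mul_le_mul_of_nonneg_left h2 (I.wt_nonneg v)
  linarith

open scoped Classical in
/-- The spines are disjoint, and at least `Γ` tours enter the subtree of each of their vertices. -/
lemma IsSkeleton.sum_spine_le (hs : IsSkeleton I ε comp root anchor) {ι : Type*}
    [Fintype ι] (g : Terminal T → ι) (hg : ∀ t, count (fun x => g x = t) ≤ I.cap) :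
    (∑ c, (I.depotDist (anchor c) - I.depotDist (root c))) * (2 * Gam ε)
      ≤ I.routeCost (fun x : Terminal T => x.1) g := by
  have hk : (0 : ℝ) < I.cap := by exact_mod_cast I.cap_pos
  have h1 : ∀ c, I.depotDist (anchor c) - I.depotDist (root c)
      = ∑ v, if root c < v ∧ v ≤ anchor c then I.wt v else 0 := by
    intro c
    rw [sub_eq_iff_eq_add, I.depotDist_eq, I.depotDist_eq, sum_filter, sum_filter,
      ← sum_add_distrib]
    refine sum_congr rfl fun v _ => ?_
    by_cases h2 : v ≤ root c
    · rw [if_pos (h2.trans (hs.root_le_anchor c)), if_pos h2, if_neg fun h => h.1.not_ge h2,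
        zero_add]
    · rw [if_neg h2, add_zero]
      refine if_congr ⟨fun h => ⟨?_, h⟩, fun h => h.2⟩ rfl rfl
      rcases le_or_le_of_le h (hs.root_le_anchor c) with h3 | h3
      · exact absurd h3 h2
      · exact lt_of_le_of_ne h3 fun h4 => h2 h4.ge
  simp only [h1]
  rw [sum_comm, sum_mul, Inst.routeCost]
  refine sum_le_sum fun v _ => ?_
  have hw := I.wt_nonneg v
  by_cases h2 : ∃ c, root c < v ∧ v ≤ anchor c
  · obtain ⟨c, hc⟩ := h2
    rw [sum_eq_single_of_mem c (mem_univ c) fun c' _ hne => if_neg fun h =>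
      hne ((hs.spine c' v h.1 h.2).1.symm.trans (hs.spine c v hc.1 hc.2).1), if_pos hc]
    have h3 := (hs.spine c v hc.1 hc.2).2
    have h4 : (count (fun x : Terminal T => v ≤ x.1) : ℝ)
        ≤ I.cap * numHits (fun x : Terminal T => x.1) g v := by
      exact_mod_cast count_le_mul_numHits g hg v
    have h5 : Gam ε ≤ numHits (fun x : Terminal T => x.1) g v := by
      refine le_of_mul_le_mul_right (a := (I.cap : ℝ)) ?_ hk
      linarith
    have := mul_le_mul_of_nonneg_left h5 hw
    linarith
  · push Not at h2
    rw [sum_eq_zero fun c _ => if_neg fun h => h2 c h.1 h.2, zero_mul]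
    positivity

lemma alpha_pos (hε : 0 < ε) : 0 < alpha ε := Real.rpow_pos_of_pos hε _

lemma alpha_le (hε : 0 < ε) (hε' : ε ≤ 1 / 32) : alpha ε ≤ 1 / 4 := by
  have h1 : (1 : ℝ) ≤ 1 / ε + 1 := by have := one_div_pos.mpr hε; linarith
  have := Real.rpow_le_rpow_of_exponent_ge hε (by linarith) h1
  rw [Real.rpow_one] at this
  unfold alpha
  linarith

lemma Inst.Dmin_le (I : Inst T) (x : Terminal T) : I.Dmin ≤ I.depotDist x.1 :=
  ciInf_le (Set.finite_range _).bddBelow x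

lemma Inst.depotDist_le_Dmax (I : Inst T) (v : T) : I.depotDist v ≤ I.Dmax := by
  obtain ⟨x, hx⟩ := exists_terminal_ge v
  exact (I.depotDist_mono hx).trans
    (le_ciSup (f := fun x : Terminal T => I.depotDist x.1) (Set.finite_range _).bddAbove x)

lemma Inst.Dmin_pos (hε : 0 < ε) (hI : I.BoundedDistances ε) : 0 < I.Dmin := by
  have h1 : 0 ≤ I.Dmax := (I.depotDist_nonneg ⊥).trans (I.depotDist_le_Dmax ⊥)
  have h2 : 0 < (1 / ε) ^ (1 / ε - 1) := Real.rpow_pos_of_pos (one_div_pos.mpr hε) _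
  exact pos_of_mul_pos_right (h1.trans_lt hI) h2.le

lemma Inst.terminal_ne_bot (hε : 0 < ε) (hI : I.BoundedDistances ε) (x : Terminal T) :
    x.1 ≠ ⊥ := fun h => by
  have h1 := (I.Dmin_pos hε hI).trans_le (I.Dmin_le x)
  rw [h, I.depotDist_bot] at h1
  exact lt_irrefl _ h1

lemma Inst.alpha_mul_Dmax_le (hε : 0 < ε) (hI : I.BoundedDistances ε) :
    alpha ε * I.Dmax ≤ ε ^ 2 * I.Dmin := by
  have h1 : alpha ε * (1 / ε) ^ (1 / ε - 1) = ε ^ 2 := by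
    unfold alpha
    rw [one_div ε, Real.inv_rpow hε.le, ← Real.rpow_neg hε.le, ← Real.rpow_add hε,
      ← Real.rpow_natCast]
    congr 1
    push_cast
    ring
  rw [← h1, mul_assoc]
  exact mul_le_mul_of_nonneg_left hI.le (alpha_pos hε).le

open scoped Classical in
/-- The new tours are cheap compared to the cost `A` of the distribution `g`. The tours `(c, 0)`
cost at most `(4 / Γ) * A = (ε / 3) * A`, by the charging scheme for the root vertices and for the
spines. All other new tours are at least half full, so their number is at most `8 * α` times the
number of full loads, and `α * Dmax ≤ ε ^ 2 * Dmin`. -/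
lemma IsSkeleton.new_cost_le (hs : IsSkeleton I ε comp root anchor) (hε : 0 < ε)
    (hε' : ε ≤ 1 / 32) (hI : I.BoundedDistances ε) {ι : Type*} [Fintype ι] (g : Terminal T → ι)
    (hg : ∀ t, count (fun x => g x = t) ≤ I.cap) (m : 𝒞 → ℕ)
    (hm : (∑ c, (m c : ℝ)) * (I.cap : ℝ) ^ 2
      ≤ 8 * (alpha ε * I.cap) * Fintype.card (Terminal T)) :
    ∑ c, (m c + 1) * (2 * I.depotDist (anchor c))
      ≤ ε * I.routeCost (fun x : Terminal T => x.1) g := by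
  set A := I.routeCost (fun x : Terminal T => x.1) g
  have hk : (0 : ℝ) < I.cap := by exact_mod_cast I.cap_pos
  have h1 : 2 * ∑ x : Terminal T, I.depotDist x.1 ≤ I.cap * A := two_mul_sum_depotDist_le g hg
  have h2 := hs.sum_spine_le g hg
  have h3 := hs.sum_root
  have hG : Gam ε * ε = 12 := by unfold Gam; field_simp
  have hW : Fintype.card (Terminal T) * I.Dmin ≤ ∑ x : Terminal T, I.depotDist x.1 := by
    rw [← nsmul_eq_mul]
    exact card_nsmul_le_sum _ _ _ fun x _ => I.Dmin_le x
  set W := ∑ x : Terminal T, I.depotDist x.1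
  have hA : 0 ≤ A := by
    have : 0 ≤ W := sum_nonneg fun x _ => I.depotDist_nonneg _
    by_contra! h
    nlinarith
  have hsplit : ∑ c, ((m c : ℝ) + 1) * (2 * I.depotDist (anchor c))
      = ∑ c, m c * (2 * I.depotDist (anchor c)) + 2 * ∑ c, I.depotDist (root c)
        + 2 * ∑ c, (I.depotDist (anchor c) - I.depotDist (root c)) := by
    rw [mul_sum, mul_sum, ← sum_add_distrib, ← sum_add_distrib]
    exact sum_congr rfl fun c _ => by ring
  have hroot : 2 * ∑ c, I.depotDist (root c) ≤ ε / 4 * A := by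
    have h4 : 2 * (∑ c, I.depotDist (root c)) * (Gam ε * I.cap) ≤ 3 * (I.cap * A) := by linarith
    have h5 : 2 * (∑ c, I.depotDist (root c)) * (Gam ε * ε) * I.cap ≤ 3 * (I.cap * A) * ε := by
      have := mul_le_mul_of_nonneg_right h4 hε.le
      linarith
    rw [hG] at h5
    refine le_of_mul_le_mul_right (a := (I.cap : ℝ)) ?_ hk
    linarith
  have hspine : 2 * ∑ c, (I.depotDist (anchor c) - I.depotDist (root c)) ≤ ε / 12 * A := by
    have h5 := mul_le_mul_of_nonneg_right h2 hε.le
    have h6 : (∑ c, (I.depotDist (anchor c) - I.depotDist (root c))) * (2 * (Gam ε * ε))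
        ≤ A * ε := by linarith
    rw [hG] at h6
    linarith
  have hfull : ∑ c, m c * (2 * I.depotDist (anchor c)) ≤ ε / 4 * A := by
    have h4 : ∑ c, m c * (2 * I.depotDist (anchor c)) ≤ (∑ c, (m c : ℝ)) * (2 * I.Dmax) := by
      rw [sum_mul]
      exact sum_le_sum fun c _ => mul_le_mul_of_nonneg_left
        (by linarith [I.depotDist_le_Dmax (anchor c)]) (Nat.cast_nonneg _)
    have h5 : (∑ c, (m c : ℝ)) * I.cap ≤ 8 * alpha ε * Fintype.card (Terminal T) := by
      refine le_of_mul_le_mul_right (a := (I.cap : ℝ)) ?_ hk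
      linarith
    have hDmax : 0 ≤ I.Dmax := (I.depotDist_nonneg ⊥).trans (I.depotDist_le_Dmax ⊥)
    have h6 := mul_le_mul_of_nonneg_right h5 (by linarith : 0 ≤ 2 * I.Dmax)
    have h7 := mul_le_mul_of_nonneg_left (Inst.alpha_mul_Dmax_le hε hI)
      (by positivity : (0 : ℝ) ≤ 16 * Fintype.card (Terminal T))
    have h8 := mul_le_mul_of_nonneg_left hW (by positivity : 0 ≤ 16 * ε ^ 2)
    have h9 := mul_le_mul_of_nonneg_left h1 (by positivity : 0 ≤ 8 * ε ^ 2)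
    have h10 : ε ^ 2 * 8 ≤ ε / 4 := by nlinarith
    have h11 := mul_le_mul_of_nonneg_right h10 (by positivity : 0 ≤ I.cap * A)
    refine h4.trans (le_of_mul_le_mul_right (a := (I.cap : ℝ)) ?_ hk)
    linarith
  rw [hsplit]
  have : 0 ≤ ε * A := by positivity
  linarith

end Costs

/-! ### The solution with few large portions -/

section Reduction

open Finset

variable {T : RootedTree} [Fintype T] {ε : ℝ} {𝒞 : Finset (graph T).Subgraph}

lemma Inst.routeCost_mono (I : Inst T) {τ τ' ι ι' : Type*} {pos : τ → T} {pos' : τ' → T}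
    {G : τ → ι} {G' : τ' → ι'} (h : ∀ v, numHits pos G v ≤ numHits pos' G' v) :
    I.routeCost pos G ≤ I.routeCost pos' G' :=
  sum_le_sum fun v _ => mul_le_mul_of_nonneg_left (Nat.cast_le.mpr (h v))
    (by linarith [I.wt_nonneg v])

open scoped Classical in
/-- Every decomposition admits a solution with the stated properties: an optimal distribution of the
terminals is repacked, and the tour `(c, 0)` of each component is filled up with dummy terminals at
the root vertex of the component. -/
theorem exists_reduced_solution (I : Inst T) (hε : 0 < ε) (hε' : ε ≤ 1 / 32)
    (hI : I.BoundedDistances ε) (hD : IsDecomposition ε I.cap 𝒞) :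
    ∃ (D : Dummies 𝒞) (S : Solution T D.tokenPos I.cap),
      (∀ c : 𝒞, (count (fun i => 0 < D.numVisited S i c) : ℝ) ≤ 2 * Gam ε / alpha ε + 1) ∧
      (∀ (c : 𝒞) (i : Fin S.numTours), 0 < D.numVisited S i c →
        alpha ε * I.cap ≤ D.numVisited S i c) ∧
      I.cost S ≤ (1 + ε) * I.opt := by
  obtain ⟨g, hg, hopt⟩ := exists_optimal I
  obtain ⟨comp, root, anchor, hs⟩ := hD.exists_skeleton I (Inst.terminal_ne_bot hε hI)
  have hX : Nonempty (Terminal T) := let ⟨x, _⟩ := exists_terminal_ge (⊥ : T); ⟨x⟩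
  have hk : (0 : ℝ) < I.cap := by exact_mod_cast I.cap_pos
  have hα := alpha_pos hε
  have hα' := alpha_le hε hε'
  set a := alpha ε * I.cap with ha
  have ha0 : 0 < a := mul_pos hα hk
  have hak : 4 * a ≤ I.cap := by nlinarith
  let n : Terminal T → 𝒞 → ℝ := fun t c => count (fun x : Terminal T => g x = t ∧ comp x.1 = c)
  have hn0 : ∀ t c, 0 < n t c ↔ ∃ x : Terminal T, g x = t ∧ comp x.1 = c := fun t c => by
    rw [Nat.cast_pos, count_pos_iff]
  have hcap : ∀ t, ∑ c, n t c ≤ I.cap := by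
    intro t
    refine le_trans (le_of_eq ?_) (Nat.cast_le.mpr (hg t))
    rw [count_eq_sum_portions g (fun x : Terminal T => comp x.1) (fun t' _ => t' = t)]
    refine (Eq.trans (sum_eq_single_of_mem t (mem_univ _) fun t' _ hne => ?_) ?_).symm
    · exact sum_eq_zero fun c _ => if_neg hne
    · exact sum_congr rfl fun c _ => if_pos rfl
  obtain ⟨F, m, hF1, hF2, hF3, hF4, hF5, hm⟩ := exists_repacking n
    (fun t c => ∃ y : Terminal T, g y = t ∧ anchor c ≤ y.1) ha0 hak
    (fun t c => Nat.cast_nonneg _) hcap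
  let G : Terminal T → Terminal T ⊕ 𝒞 × ℕ := fun x => F (g x) (comp x.1)
  have hG2 : ∀ {x c j}, G x = Sum.inr (c, j) → comp x.1 = c := fun h => (hF2 _ _ _ _ h).1.symm
  -- the number of real terminals in `c` on the tour `s`
  let R : Terminal T ⊕ 𝒞 × ℕ → 𝒞 → ℕ := fun s c =>
    count (fun x : Terminal T => G x = s ∧ comp x.1 = c)
  have hR : ∀ s c, (R s c : ℝ) = ∑ t, if F t c = s then n t c else 0 := by
    intro s c
    have := count_eq_sum_portions g (fun x : Terminal T => comp x.1)
      (fun t c' => F t c' = s ∧ c' = c)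
    refine this.trans (sum_congr rfl fun t _ => ?_)
    refine Eq.trans (sum_eq_single_of_mem c (mem_univ _) fun c' _ hne => ?_) ?_
    · exact if_neg fun h => hne h.2
    · by_cases h : F t c = s <;> simp [h, n]
  have hRa : ∀ s c, 0 < R s c → s ≠ Sum.inr (c, 0) → a ≤ R s c := by
    intro s c hpos hne
    obtain ⟨x, rfl, rfl⟩ := count_pos_iff.mp hpos
    rw [hR]
    convert hF5 (g x) (comp x.1) ((hn0 _ _).mpr ⟨x, rfl, rfl⟩) hne
  have hload : ∀ s, count (fun x => G x = s) ≤ I.cap := by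
    intro s
    rw [← Nat.cast_le (α := ℝ)]
    refine (count_eq_sum_portions g (fun x : Terminal T => comp x.1)
      (fun t c => F t c = s)).trans_le ?_
    rcases s with t' | ⟨c, j⟩
    · convert hF3 t'
    · have h1 : ∀ t, (∑ c', if F t c' = Sum.inr (c, j) then n t c' else 0)
          = if F t c = Sum.inr (c, j) then n t c else 0 := fun t =>
        sum_eq_single_of_mem c (mem_univ _) fun c' _ hne =>
          if_neg fun h => hne (hF2 _ _ _ _ h).1.symm
      convert hF4 c j using 2 with t
      convert h1 t
  let L : 𝒞 → ℕ := fun c => count (fun x => G x = Sum.inr (c, 0))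
  have hRL : ∀ c, R (Sum.inr (c, 0)) c = L c := fun c => by
    refine congrArg count (funext fun x => propext ⟨fun h => h.1, fun h => ⟨h, hG2 h⟩⟩)
  let d : 𝒞 → ℕ := fun c => if L c = 0 then 0 else ⌈a⌉₊ - L c
  have hLd : ∀ c, L c + d c ≤ I.cap := by
    intro c
    have h1 : L c ≤ I.cap := hload (Sum.inr (c, 0))
    have h2 : ⌈a⌉₊ ≤ I.cap := Nat.ceil_le.mpr (by linarith)
    simp only [d]
    split_ifs <;> omega
  let e₀ := Fintype.equivFin (Σ c : 𝒞, Fin (d c))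
  let D : Dummies 𝒞 := ⟨_, fun j => (e₀.symm j).1, fun j => root (e₀.symm j).1,
    fun j => hs.root_mem _, fun j => hs.root_internal _⟩
  have hDd : ∀ c, count (fun j => D.comp j = c) = d c := by
    intro c
    rw [count_eq_card, card_filter, Fintype.sum_equiv e₀.symm _
      (fun p : Σ c : 𝒞, Fin (d c) => if p.1 = c then 1 else 0) fun j => rfl, Fintype.sum_sigma,
      sum_eq_single_of_mem c (mem_univ _) fun c' _ hne => sum_eq_zero fun i _ => if_neg hne]
    simp
  let G' : D.Token → Terminal T ⊕ 𝒞 × ℕ := Sum.elim G fun j => Sum.inr (D.comp j, 0)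
  have hdummy : ∀ j, ∃ x, G x = Sum.inr (D.comp j, 0) := by
    intro j
    have h1 : 0 < d (D.comp j) := by
      rw [← hDd]; exact count_pos_iff.mpr ⟨j, rfl⟩
    have h2 : 0 < L (D.comp j) := Nat.pos_of_ne_zero fun h => by simp [d, h] at h1
    exact count_pos_iff.mp h2
  have hload' : ∀ s, count (fun y => G' y = s) ≤ I.cap := by
    intro s
    rw [count_sumType]
    by_cases hsc : ∃ c, s = Sum.inr (c, 0)
    · obtain ⟨c, rfl⟩ := hsc
      refine le_trans (add_le_add le_rfl ((count_mono fun j hj => ?_).trans (hDd c).le)) (hLd c)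
      exact congrArg Prod.fst (Sum.inr.inj hj)
    · have h0 : count (fun j => G' (Sum.inr j) = s) = 0 := by
        by_contra h
        obtain ⟨j, hj⟩ := count_pos_iff.mp (Nat.pos_of_ne_zero h)
        exact hsc ⟨_, hj.symm⟩
      rw [h0]
      exact hload s
  obtain ⟨S, e, hSe, hcost⟩ := exists_solution I D.tokenPos (ι := Set.range G')
    (Set.rangeFactorization G') (k := I.cap) fun s => by
      refine (count_mono fun y hy => ?_).trans (hload' s.1)
      exact congrArg Subtype.val hy
  have hvis : ∀ i y, y ∈ S.visits i ↔ G' y = (e i).1 := fun i y =>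
    (hSe i y).trans Subtype.ext_iff
  have hnum : ∀ i c, D.numVisited S i c =
      R (e i).1 c + count (fun j => Sum.inr (D.comp j, 0) = (e i).1 ∧ D.comp j = c) := by
    intro i c
    refine (count_sumType _).trans ?_
    congr 1
    · refine congrArg count (funext fun x => propext (and_congr (hvis i _) (hs.terminal_mem c x)))
    · exact congrArg count (funext fun j => propext (and_congr (hvis i _) Iff.rfl))
  have hdum0 : ∀ s c, s ≠ Sum.inr (c, 0) →
      count (fun j => (Sum.inr (D.comp j, 0) : Terminal T ⊕ 𝒞 × ℕ) = s ∧ D.comp j = c) = 0 := by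
    intro s c hne
    by_contra h
    obtain ⟨j, rfl, rfl⟩ := count_pos_iff.mp (Nat.pos_of_ne_zero h)
    exact hne rfl
  have hR_of : ∀ i c, 0 < D.numVisited S i c → (e i).1 ≠ Sum.inr (c, 0) → a ≤ R (e i).1 c := by
    intro i c hpos hne
    rw [hnum, hdum0 _ _ hne, add_zero] at hpos
    exact hRa _ _ hpos hne
  refine ⟨D, S, fun c => ?_, fun c i hpos => ?_, ?_⟩
  · -- All tours but one have at least `a` of the at most `2 * Γ * k` real terminals.
    rw [count_eq_card]
    set Q : Finset (Fin S.numTours) := {i | 0 < D.numVisited S i c}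
    have h1 : #Q ≤ #{i ∈ Q | (e i).1 ≠ Sum.inr (c, 0)} + 1 := by
      rw [← card_filter_add_card_filter_not (s := Q) (fun i => (e i).1 ≠ Sum.inr (c, 0))]
      refine Nat.add_le_add_left (card_le_one.mpr fun i hi i' hi' => ?_) _
      have h2 := not_not.mp (mem_filter.mp hi).2
      have h3 := not_not.mp (mem_filter.mp hi').2
      exact e.injective (Subtype.ext (h2.trans h3.symm))
    have h2 : (∑ i ∈ Q with (e i).1 ≠ Sum.inr (c, 0), R (e i).1 c) ≤ numTerminals c.1 := by
      refine sum_count_le _ _ _ (fun i x h => (hs.terminal_mem c x).mpr h.2) fun i i' x h h' => ?_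
      exact e.injective (Subtype.ext (h.1.symm.trans h'.1))
    have h3 : (#{i ∈ Q | (e i).1 ≠ Sum.inr (c, 0)} : ℝ) * a ≤ 2 * Gam ε * I.cap := by
      refine le_trans ?_ ((Nat.cast_le.mpr h2).trans (hD.terminals_le c.1 c.2))
      rw [← nsmul_eq_mul, Nat.cast_sum]
      refine card_nsmul_le_sum _ _ _ fun i hi => ?_
      obtain ⟨h4, h5⟩ := mem_filter.mp hi
      exact hR_of i c (mem_filter.mp h4).2 h5
    have h4 : (#{i ∈ Q | (e i).1 ≠ Sum.inr (c, 0)} : ℝ) ≤ 2 * Gam ε / alpha ε := by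
      rw [le_div_iff₀ hα]
      refine le_of_mul_le_mul_right (a := (I.cap : ℝ)) ?_ hk
      linarith
    have h5 : (#Q : ℝ) ≤ #{i ∈ Q | (e i).1 ≠ Sum.inr (c, 0)} + 1 := by exact_mod_cast h1
    linarith
  · by_cases hne : (e i).1 = Sum.inr (c, 0)
    · have h1 : count (fun j => (Sum.inr (D.comp j, 0) : Terminal T ⊕ 𝒞 × ℕ) = Sum.inr (c, 0) ∧
          D.comp j = c) = d c := by
        rw [← hDd c]
        exact congrArg count (funext fun j => propext ⟨fun h => h.2, fun h => ⟨by rw [h], h⟩⟩)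
      rw [hnum, hne, hRL, h1] at hpos ⊢
      have h2 : ⌈a⌉₊ ≤ L c + d c := by
        by_cases hL : L c = 0
        · simp [d, hL] at hpos
        · simp only [d, if_neg hL]; omega
      exact (Nat.le_ceil a).trans (Nat.cast_le.mpr h2)
    · refine (hR_of i c hpos hne).trans (Nat.cast_le.mpr ?_)
      rw [hnum]
      exact Nat.le_add_right _ _
  · have h1 : I.cost S ≤ I.routeCost (fun x : Terminal T => x.1) G := by
      rw [hcost]
      refine I.routeCost_mono fun v => ?_
      unfold numHits
      rw [← Set.ncard_image_of_injective _ Subtype.val_injective, ← Set.image_comp]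
      refine Set.ncard_le_ncard ?_ (Set.toFinite _)
      rintro _ ⟨x | j, hx, rfl⟩
      · exact ⟨x, hx, rfl⟩
      · obtain ⟨x, hxj⟩ := hdummy j
        refine ⟨x, le_trans hx ?_, hxj⟩
        exact hs.root_le (D.comp j) _ ((hs.terminal_mem _ x).mpr (hG2 hxj))
    have hmass : ∑ t, ∑ c, n t c = Fintype.card (Terminal T) := by
      have := count_eq_sum_portions g (fun x : Terminal T => comp x.1) (fun _ _ => True)
      simp only [if_true] at this
      rw [← this, count_eq_card, filter_true, card_univ]
    have h2 := hs.routeCost_le g F m (fun x t' h => ?_) hF2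
    · have h3 := hs.new_cost_le hε hε' hI g hg m (by rw [← hmass]; exact hm)
      have h4 : (1 + ε) * I.routeCost (fun x : Terminal T => x.1) g ≤ (1 + ε) * I.opt :=
        mul_le_mul_of_nonneg_left hopt (by linarith)
      linarith
    · obtain ⟨h3, h4⟩ := hF1 _ _ _ ((hn0 _ _).mpr ⟨x, rfl, rfl⟩) h
      exact ⟨(hn0 _ _).mp h3, h4⟩

end Reduction

/-! ### Heavy vertices and cut sets -/

section Heavy

open Finset

variable {T : RootedTree}

lemma eq_of_covBy_of_covBy_of_le {v y z x : T} (hy : v ⋖ y) (hz : v ⋖ z) (hyx : y ≤ x)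
    (hzx : z ≤ x) : y = z := by
  rcases le_or_le_of_le hyx hzx with h | h
  · exact h.eq_of_not_lt (hz.2 hy.lt)
  · exact (h.eq_of_not_lt (hy.2 hz.lt)).symm

variable [Fintype T]

lemma Inst.exists_children (I : Inst T) {v : T} (hv : ¬ IsMax v) :
    ∃ y z, y ≠ z ∧ v ⋖ y ∧ v ⋖ z ∧ ∀ u, v ⋖ u → u = y ∨ u = z := by
  classical
  have h := I.two_children v hv
  rw [count_eq_card, card_eq_two] at h
  obtain ⟨y, z, hne, h⟩ := h
  have h' : ∀ u, v ⋖ u ↔ u = y ∨ u = z := fun u => by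
    have := congrArg (u ∈ ·) h
    simpa using this
  exact ⟨y, z, hne, (h' y).mpr (Or.inl rfl), (h' z).mpr (Or.inr rfl), fun u => (h' u).mp⟩

/-- The number of terminals in the subtree rooted at `v`. -/
noncomputable def numBelow (v : T) : ℕ := count (fun x : Terminal T => v ≤ x.1)

lemma numBelow_anti {u v : T} (h : u ≤ v) : numBelow v ≤ numBelow u :=
  count_mono fun _ hx => h.trans hx

lemma numBelow_le_add {v y z : T} (hv : ¬ IsMax v) (h : ∀ u, v ⋖ u → u = y ∨ u = z) :
    numBelow v ≤ numBelow y + numBelow z := by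
  classical
  simp only [numBelow, count_eq_card]
  refine (card_le_card fun x hx => ?_).trans (card_union_le _ _)
  simp only [mem_union, mem_filter, mem_univ, true_and] at hx ⊢
  obtain ⟨u, hu, hux⟩ := exists_child_le (lt_of_le_of_ne hx fun h => hv (h ▸ x.2))
  rcases h u hu with rfl | rfl
  · exact Or.inl hux
  · exact Or.inr hux

/-- A vertex is heavy if its subtree has at least `M` terminals. -/
def IsHeavy (M : ℝ) (v : T) : Prop := M ≤ numBelow v

/-- A branch vertex is an internal vertex all of whose children are heavy. -/
def IsBranch (M : ℝ) (v : T) : Prop := ¬ IsMax v ∧ ∀ y, v ⋖ y → IsHeavy M y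

/-- A tip is a heavy vertex without a heavy child. -/
def IsTip (M : ℝ) (v : T) : Prop := IsHeavy M v ∧ ∀ y, v ⋖ y → ¬ IsHeavy M y

variable {M : ℝ}

lemma IsHeavy.mono {u v : T} (hv : IsHeavy M v) (h : u ≤ v) : IsHeavy M u :=
  le_trans hv (Nat.cast_le.mpr (numBelow_anti h))

lemma IsHeavy.not_isMax (hM : 1 < M) {v : T} (hv : IsHeavy M v) : ¬ IsMax v := by
  classical
  intro hmax
  have h1 : numBelow v ≤ 1 := by
    rw [numBelow, count_eq_card, card_le_one]
    intro x hx y hy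
    simp only [mem_filter, mem_univ, true_and] at hx hy
    exact Subtype.ext ((hmax.eq_of_le hx).symm.trans (hmax.eq_of_le hy))
  have h2 : (numBelow v : ℝ) ≤ 1 := by exact_mod_cast h1
  have h3 : M ≤ numBelow v := hv
  linarith

lemma IsTip.not_isHeavy {v u : T} (hv : IsTip M v) (h : v < u) : ¬ IsHeavy M u := fun hu => by
  obtain ⟨y, hy, hyu⟩ := exists_child_le h
  exact hv.2 y hy (hu.mono hyu)

lemma IsTip.not_isBranch {v : T} (I : Inst T) (hv : IsTip M v) : ¬ IsBranch M v := fun h => by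
  obtain ⟨y, z, -, hy, -, -⟩ := I.exists_children h.1
  exact hv.2 y hy (h.2 y hy)

lemma IsBranch.isHeavy (I : Inst T) {v : T} (hv : IsBranch M v) : IsHeavy M v := by
  obtain ⟨y, z, -, hy, -, -⟩ := I.exists_children hv.1
  exact (hv.2 y hy).mono hy.le

lemma IsHeavy.exists_tip {v : T} (hv : IsHeavy M v) : ∃ t, IsTip M t ∧ v ≤ t := by
  obtain ⟨t, hvt, ht⟩ := Finite.exists_le_maximal (p := fun x => IsHeavy M x) hv
  exact ⟨t, ⟨ht.prop, fun y hy h => hy.lt.not_ge (ht.le_of_ge h hy.le)⟩, hvt⟩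

/-- The last common ancestor of two incomparable heavy vertices is a branch vertex. -/
lemma isBranch_inf (I : Inst T) {u v : T} (hu : IsHeavy M u) (hv : IsHeavy M v) (huv : ¬ u ≤ v)
    (hvu : ¬ v ≤ u) : IsBranch M (u ⊓ v) := by
  have h1 : u ⊓ v < u := lt_of_le_of_ne inf_le_left fun h => huv (inf_eq_left.mp h)
  have h2 : u ⊓ v < v := lt_of_le_of_ne inf_le_right fun h => hvu (inf_eq_right.mp h)
  obtain ⟨y, hy, hyu⟩ := exists_child_le h1
  obtain ⟨z, hz, hzv⟩ := exists_child_le h2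
  have hne : y ≠ z := fun h => hy.lt.not_ge (le_inf hyu (h ▸ hzv))
  refine ⟨fun h => h.not_lt h1, fun w hw => ?_⟩
  obtain ⟨a, b, hab, ha, hb, hall⟩ := I.exists_children fun h => h.not_lt h1
  have : w = y ∨ w = z := by
    rcases hall y hy with rfl | rfl <;> rcases hall z hz with rfl | rfl <;>
      rcases hall w hw with rfl | rfl <;> simp_all
  rcases this with rfl | rfl
  · exact hu.mono hyu
  · exact hv.mono hzv

/-- Branch vertices can be mapped injectively to tips below them. If `first v` is the tip below `v`
that comes first in a fixed numbering, a branch vertex `b` is mapped to `first y`, where `y` is the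
child of `b` that is not above `first b`. -/
lemma exists_tip_of_branch (I : Inst T) :
    ∃ tip : T → T, (∀ b, IsBranch M b → IsTip M (tip b) ∧ b ≤ tip b) ∧
      ∀ b b', IsBranch M b → IsBranch M b' → tip b = tip b' → b = b' := by
  classical
  let ν := Fintype.equivFin T
  have hfirst : ∀ v : T, ∃ t,
      IsHeavy M v → IsTip M t ∧ v ≤ t ∧ ∀ t', IsTip M t' → v ≤ t' → ν t ≤ ν t' := by
    intro v
    by_cases hv : IsHeavy M v
    · obtain ⟨t₀, ht₀⟩ := hv.exists_tip
      obtain ⟨t, ht, hmin⟩ := exists_min_image {t : T | IsTip M t ∧ v ≤ t} ν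
        ⟨t₀, by simpa using ht₀⟩
      simp only [mem_filter, mem_univ, true_and] at ht hmin
      exact ⟨t, fun _ => ⟨ht.1, ht.2, fun t' h1 h2 => hmin t' ⟨h1, h2⟩⟩⟩
    · exact ⟨v, fun h => absurd h hv⟩
  choose first hfirst using hfirst
  have hcons : ∀ v u, IsHeavy M v → v ≤ u → u ≤ first v → first u = first v := by
    intro v u hv hvu hu
    obtain ⟨h1, -, h3⟩ := hfirst v hv
    obtain ⟨h4, h5, h6⟩ := hfirst u (h1.1.mono hu)
    exact ν.injective (le_antisymm (h6 _ h1 hu) (h3 _ h4 (hvu.trans h5)))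
  have hchild : ∀ b, ∃ y, IsBranch M b → b ⋖ y ∧ ¬ y ≤ first b := by
    intro b
    by_cases hb : IsBranch M b
    · obtain ⟨y, z, hne, hy, hz, -⟩ := I.exists_children hb.1
      by_cases h : y ≤ first b
      · exact ⟨z, fun _ => ⟨hz, fun h' => hne (eq_of_covBy_of_covBy_of_le hy hz h h')⟩⟩
      · exact ⟨y, fun _ => ⟨hy, h⟩⟩
    · exact ⟨b, fun h => absurd h hb⟩
  choose child hchild using hchild
  have htip : ∀ b, IsBranch M b → IsTip M (first (child b)) ∧ child b ≤ first (child b) :=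
    fun b hb => ⟨(hfirst _ (hb.2 _ (hchild b hb).1)).1, (hfirst _ (hb.2 _ (hchild b hb).1)).2.1⟩
  refine ⟨fun b => first (child b), fun b hb =>
    ⟨(htip b hb).1, (hchild b hb).1.le.trans (htip b hb).2⟩, fun b b' hb hb' heq => ?_⟩
  have key : ∀ b b', IsBranch M b → IsBranch M b' →
      first (child b) = first (child b') → ¬ b < b' := by
    intro b b' hb hb' heq hlt
    obtain ⟨h1, h2⟩ := hchild b hb
    obtain ⟨h3, h4⟩ := hchild b' hb'
    have h5 : b' ≤ first (child b) := by rw [heq]; exact h3.le.trans (htip b' hb').2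
    have h6 : child b ≤ b' := by
      rcases le_or_le_of_le (htip b hb).2 h5 with h | h
      · exact h
      · exact (h.eq_of_not_lt (h1.2 hlt)).ge
    have h7 := hcons (child b) b' (hb.2 _ h1) h6 h5
    exact h4 (by rw [h7, heq]; exact (htip b' hb').2)
  dsimp only at heq
  have h1 : b ≤ first (child b) := (hchild b hb).1.le.trans (htip b hb).2
  have h2 : b' ≤ first (child b) := by rw [heq]; exact (hchild b' hb').1.le.trans (htip b' hb').2
  rcases le_or_le_of_le h1 h2 with h | h
  · exact h.eq_of_not_lt (key b b' hb hb' heq)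
  · exact (h.eq_of_not_lt (key b' b hb' hb heq.symm)).symm

/-- The cut vertices at which the tree is split into components: the depot, the branch vertices, the
tips, and further heavy vertices such that the pieces of the heavy paths between them have at most
`2 * M` terminals. -/
structure IsCutSet (M : ℝ) (K : Finset T) : Prop where
  heavy : ∀ v ∈ K, IsHeavy M v
  bot_mem : ⊥ ∈ K
  branch_mem : ∀ v, IsBranch M v → v ∈ K
  tip_mem : ∀ v, IsTip M v → v ∈ K
  gap : ∀ x y, IsHeavy M x → IsHeavy M y → x ≤ y → (∀ u, x ≤ u → u < y → ¬ IsBranch M u) →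
    (∀ u ∈ K, x < u → ¬ u < y) → (numBelow x : ℝ) ≤ numBelow y + 2 * M

open scoped Classical in
lemma isCutSet_filter_isHeavy (I : Inst T) (hM : 1 < M) (hbot : IsHeavy M (⊥ : T)) :
    IsCutSet M ({v | IsHeavy M v} : Finset T) := by
  refine ⟨fun v hv => by simpa using hv, by simpa using hbot,
    fun v hv => by simpa using hv.isHeavy I, fun v hv => by simpa using hv.1,
    fun x y hx hy hxy hbr hK => ?_⟩
  rcases hxy.eq_or_lt with rfl | hlt
  · linarith
  obtain ⟨u, hu, huy⟩ := exists_child_le hlt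
  obtain rfl : u = y := huy.eq_of_not_lt (hK u (by simpa using hy.mono huy) hu.lt)
  have hmax := hx.not_isMax hM
  have h1 : ¬ IsBranch M x := hbr x le_rfl hlt
  obtain ⟨z, hz, hzl⟩ : ∃ z, x ⋖ z ∧ ¬ IsHeavy M z := by
    by_contra! h
    exact h1 ⟨hmax, h⟩
  have hzu : z ≠ u := fun h => hzl (h ▸ hy)
  have h2 : numBelow x ≤ numBelow u + numBelow z := by
    refine numBelow_le_add hmax fun w hw => ?_
    obtain ⟨a, b, -, -, -, hall⟩ := I.exists_children hmax
    rcases hall u hu with rfl | rfl <;> rcases hall z hz with rfl | rfl <;>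
      rcases hall w hw with rfl | rfl <;> simp_all
  have h3 : (numBelow x : ℝ) ≤ numBelow u + numBelow z := by exact_mod_cast h2
  have h4 : (numBelow z : ℝ) < M := not_le.mp hzl
  linarith

open scoped Classical in
/-- In a minimal cut set, the pieces above and below an optional cut vertex cannot be merged. -/
lemma exists_gap_of_minimal {K : Finset T} (hK : Minimal (IsCutSet M) K) {e : T} (he : e ∈ K)
    (hbot : e ≠ ⊥) (hbr : ¬ IsBranch M e) (htip : ¬ IsTip M e) :
    ∃ x y, x < e ∧ e < y ∧ IsHeavy M y ∧ (∀ u, x ≤ u → u < y → ¬ IsBranch M u) ∧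
      (∀ u ∈ K, x < u → u < y → u = e) ∧ (numBelow y : ℝ) + 2 * M < numBelow x := by
  by_contra! hcon
  have hcut : IsCutSet M (K.erase e) := by
    refine ⟨fun v hv => hK.prop.heavy v (mem_of_mem_erase hv),
      mem_erase.mpr ⟨hbot.symm, hK.prop.bot_mem⟩,
      fun v hv => mem_erase.mpr ⟨fun h => hbr (h ▸ hv), hK.prop.branch_mem v hv⟩,
      fun v hv => mem_erase.mpr ⟨fun h => htip (h ▸ hv), hK.prop.tip_mem v hv⟩,
      fun x y hx hy hxy h1 h2 => ?_⟩
    by_cases hmid : x < e ∧ e < y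
    · refine hcon x y hmid.1 hmid.2 hy h1 fun u hu hxu huy => ?_
      by_contra hne
      exact h2 u (mem_erase.mpr ⟨hne, hu⟩) hxu huy
    · refine hK.prop.gap x y hx hy hxy h1 fun u hu hxu huy => ?_
      by_cases hne : u = e
      · exact hmid ⟨hne ▸ hxu, hne ▸ huy⟩
      · exact h2 u (mem_erase.mpr ⟨hne, hu⟩) hxu huy
  exact (mem_erase.mp (hK.le_of_le hcut (erase_subset e K) he)).1 rfl

end Heavy

/-! ### The pieces between cut vertices -/

section Pieces

open Finset

variable {T : RootedTree} {M : ℝ} {K : Finset T}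

/-- The piece with root vertex `p.1`: the vertices `v ≥ p.2` such that no cut vertex lies strictly
between `p.1` and `v`, together with `p.1`. -/
def piece (K : Finset T) (p : T × T) : Set T :=
  {v | v = p.1 ∨ (p.1 < v ∧ p.2 ≤ v ∧ ∀ u ∈ K, p.1 < u → ¬ u < v)}

/-- The piece as a subgraph of the tree. -/
def pieceGraph (K : Finset T) (p : T × T) : (graph T).Subgraph :=
  (⊤ : (graph T).Subgraph).induce (piece K p)

/-- `e` is a cut vertex in the piece `p`, other than its root vertex. -/
def IsCut (K : Finset T) (p : T × T) (e : T) : Prop := e ∈ K ∧ e ∈ piece K p ∧ p.1 < e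

lemma mem_piece_of_lt {p : T × T} {v : T} (hv : v ∈ piece K p) (h : p.1 ≠ v) :
    p.1 < v ∧ p.2 ≤ v ∧ ∀ u ∈ K, p.1 < u → ¬ u < v := hv.resolve_left h.symm

lemma root_mem_piece (p : T × T) : p.1 ∈ piece K p := Or.inl rfl

lemma le_of_mem_piece {p : T × T} {v : T} (hv : v ∈ piece K p) : p.1 ≤ v := by
  rcases hv with h | h
  · exact h.ge
  · exact h.1.le

lemma isRootOf_pieceGraph (p : T × T) : IsRootOf (pieceGraph K p) p.1 :=
  ⟨root_mem_piece p, fun _ hv => le_of_mem_piece hv⟩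

lemma snd_le_of_isCut {p : T × T} {e : T} (he : IsCut K p e) : p.2 ≤ e :=
  (mem_piece_of_lt he.2.1 he.2.2.ne).2.1

/-- A subgraph that contains the path from its root vertex to each of its vertices is connected. -/
lemma connected_of_pred_adj [Finite T] {c : (graph T).Subgraph} {r : T} (hr : r ∈ c.verts)
    (h : ∀ v ∈ c.verts, v ≠ r → c.Adj (Order.pred v) v ∧ v ≠ ⊥) : c.Connected := by
  rw [SimpleGraph.Subgraph.connected_iff']
  rw [SimpleGraph.connected_iff_exists_forall_reachable]
  refine ⟨⟨r, hr⟩, ?_⟩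
  rintro ⟨v, hv⟩
  induction v using WellFoundedLT.induction with
  | ind v ih =>
    by_cases hvr : v = r
    · subst hvr; exact SimpleGraph.Reachable.refl _
    · obtain ⟨hadj, h0⟩ := h v hv hvr
      have h1 : c.coe.Adj ⟨_, hadj.fst_mem⟩ ⟨v, hv⟩ := hadj
      exact (ih _ (pred_lt h0) hadj.fst_mem).trans h1.reachable

variable [Fintype T]

/-- The pieces are indexed by pairs. A cut vertex `r` that is not a branch vertex is the root vertex
of the single piece `(r, r)`; a branch vertex `r` is the root vertex of the pieces `(r, s)`, one for
each child `s`. -/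
def IsIndex (M : ℝ) (K : Finset T) (p : T × T) : Prop :=
  p.1 ∈ K ∧ ((¬ IsBranch M p.1 ∧ p.2 = p.1) ∨ (IsBranch M p.1 ∧ p.1 ⋖ p.2))

lemma IsIndex.fst_le_snd {p : T × T} (hp : IsIndex M K p) : p.1 ≤ p.2 := by
  rcases hp.2 with ⟨-, h⟩ | ⟨-, h⟩
  · exact h.ge
  · exact h.le

lemma IsIndex.snd_le_of_lt {p : T × T} (hp : IsIndex M K p) {u v : T} (hu : p.1 < u) (huv : u ≤ v)
    (hv : p.2 ≤ v) : p.2 ≤ u := by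
  rcases hp.2 with ⟨-, h⟩ | ⟨-, h⟩
  · exact h ▸ hu.le
  · rcases le_or_le_of_le hv huv with h1 | h1
    · exact h1
    · exact (h1.eq_of_not_lt (h.2 hu)).ge

lemma IsIndex.snd_isHeavy {p : T × T} (hp : IsIndex M K p) (hK : IsCutSet M K) :
    IsHeavy M p.2 := by
  rcases hp.2 with ⟨-, h⟩ | ⟨h1, h⟩
  · exact h ▸ hK.heavy _ hp.1
  · exact h1.2 _ h

lemma pred_adj_pieceGraph {p : T × T} (hp : IsIndex M K p) {v : T} (hv : v ∈ piece K p)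
    (hne : p.1 ≠ v) : (pieceGraph K p).Adj (Order.pred v) v := by
  obtain ⟨h1, h2, h3⟩ := mem_piece_of_lt hv hne
  have h0 : v ≠ ⊥ := (bot_le.trans_lt h1).ne'
  refine ⟨?_, hv, pred_adj h0⟩
  rcases (Order.le_pred_of_lt h1).eq_or_lt with h4 | h4
  · exact Or.inl h4.symm
  · exact Or.inr ⟨h4, hp.snd_le_of_lt h4 (pred_lt h0).le h2,
      fun u hu hpu huv => h3 u hu hpu (huv.trans (pred_lt h0))⟩

lemma mem_edgeSet_pieceGraph {p : T × T} (hp : IsIndex M K p) {v : T} (hv : v ≠ ⊥) :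
    s(Order.pred v, v) ∈ (pieceGraph K p).edgeSet ↔ v ∈ piece K p ∧ p.1 ≠ v :=
  ⟨fun h => ⟨mem_of_pred_edge_mem h, (lt_of_pred_edge_mem (isRootOf_pieceGraph p) hv h).ne⟩,
    fun h => SimpleGraph.Subgraph.mem_edgeSet.mpr (pred_adj_pieceGraph hp h.1 h.2)⟩

/-- The edge above a vertex lies in a single piece. -/
lemma IsIndex.eq_of_mem {p q : T × T} (hp : IsIndex M K p) (hq : IsIndex M K q) {v : T}
    (hvp : v ∈ piece K p) (hpv : p.1 ≠ v) (hvq : v ∈ piece K q) (hqv : q.1 ≠ v) : p = q := by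
  obtain ⟨h1, h2, h3⟩ := mem_piece_of_lt hvp hpv
  obtain ⟨h4, h5, h6⟩ := mem_piece_of_lt hvq hqv
  have hfst : p.1 = q.1 := by
    rcases le_or_le_of_le h1.le h4.le with h | h
    · exact h.eq_of_not_lt fun hlt => h3 _ hq.1 hlt h4
    · exact (h.eq_of_not_lt fun hlt => h6 _ hp.1 hlt h1).symm
  refine Prod.ext hfst ?_
  rcases hp.2 with ⟨h7, h8⟩ | ⟨h7, h8⟩ <;> rcases hq.2 with ⟨h9, h10⟩ | ⟨h9, h10⟩
  · rw [h8, h10, hfst]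
  · exact absurd (hfst ▸ h9) h7
  · exact absurd (hfst ▸ h7) h9
  · exact eq_of_covBy_of_covBy_of_le h8 (hfst ▸ h10) h2 h5

lemma exists_index (M : ℝ) {r x : T} (hr : r ∈ K) (hx : r < x) :
    ∃ s, IsIndex M K (r, s) ∧ s ≤ x := by
  by_cases h : IsBranch M r
  · obtain ⟨y, hy, hyx⟩ := exists_child_le hx
    exact ⟨y, ⟨hr, Or.inr ⟨h, hy⟩⟩, hyx⟩
  · exact ⟨r, ⟨hr, Or.inl ⟨h, rfl⟩⟩, hx.le⟩

lemma exists_piece_mem (hK : IsCutSet M K) {v : T} (hv : v ≠ ⊥) :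
    ∃ p, IsIndex M K p ∧ v ∈ piece K p ∧ p.1 ≠ v := by
  obtain ⟨r, -, hr⟩ := Finite.exists_le_maximal (p := fun u => u ∈ K ∧ u < v)
    ⟨hK.bot_mem, bot_lt_iff_ne_bot.mpr hv⟩
  obtain ⟨s, hs, hsv⟩ := exists_index M hr.prop.1 hr.prop.2
  refine ⟨(r, s), hs, Or.inr ⟨hr.prop.2, hsv, fun u hu hru huv => ?_⟩, hr.prop.2.ne⟩
  exact hru.not_ge (hr.le_of_ge ⟨hu, huv⟩ hru.le)

lemma pieceGraph_connected {p : T × T} (hp : IsIndex M K p) : (pieceGraph K p).Connected :=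
  connected_of_pred_adj (root_mem_piece p) fun _ hv hne =>
    ⟨pred_adj_pieceGraph hp hv hne.symm,
      (bot_le.trans_lt (lt_of_le_of_ne (le_of_mem_piece hv) hne.symm)).ne'⟩

lemma exists_mem_piece_ne (hM : 1 < M) (hK : IsCutSet M K) {p : T × T} (hp : IsIndex M K p) :
    ∃ v ∈ piece K p, p.1 ≠ v := by
  rcases hp.2 with ⟨-, h⟩ | ⟨-, h⟩
  · obtain ⟨x, hx⟩ := not_isMax_iff.mp ((hK.heavy _ hp.1).not_isMax hM)
    obtain ⟨y, hy, -⟩ := exists_child_le hx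
    exact ⟨y, Or.inr ⟨hy.lt, h ▸ hy.le, fun u _ h1 h2 => hy.2 h1 h2⟩, hy.ne⟩
  · exact ⟨p.2, Or.inr ⟨h.lt, le_rfl, fun u _ h1 h2 => h.2 h1 h2⟩, h.ne⟩

lemma pieceGraph_edges_nonempty (hM : 1 < M) (hK : IsCutSet M K) {p : T × T}
    (hp : IsIndex M K p) : (pieceGraph K p).edgeSet.Nonempty := by
  obtain ⟨v, hv, hne⟩ := exists_mem_piece_ne hM hK hp
  exact ⟨_, SimpleGraph.Subgraph.mem_edgeSet.mpr (pred_adj_pieceGraph hp hv hne)⟩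

lemma pieceGraph_injective (hM : 1 < M) (hK : IsCutSet M K) {p q : T × T} (hp : IsIndex M K p)
    (hq : IsIndex M K q) (h : pieceGraph K p = pieceGraph K q) : p = q := by
  have hverts : piece K p = piece K q := congrArg (fun c => c.verts) h
  have hroot : p.1 = q.1 := (h ▸ isRootOf_pieceGraph p : IsRootOf (pieceGraph K q) p.1).unique
    (isRootOf_pieceGraph q)
  obtain ⟨v, hv, hne⟩ := exists_mem_piece_ne hM hK hp
  exact hp.eq_of_mem hq hv hne (hverts ▸ hv) (hroot ▸ hne)

lemma IsIndex.isCut_unique (I : Inst T) (hK : IsCutSet M K) {p : T × T} (hp : IsIndex M K p)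
    {e e' : T} (he : IsCut K p e) (he' : IsCut K p e') : e = e' := by
  have h3 := (mem_piece_of_lt he.2.1 he.2.2.ne).2.2
  have h3' := (mem_piece_of_lt he'.2.1 he'.2.2.ne).2.2
  by_cases h : e ≤ e'
  · exact h.eq_of_not_lt (h3' e he.1 he.2.2)
  by_cases h' : e' ≤ e
  · exact (h'.eq_of_not_lt (h3 e' he'.1 he'.2.2)).symm
  have hbr := isBranch_inf I (hK.heavy e he.1) (hK.heavy e' he'.1) h h'
  have hle : p.2 ≤ e ⊓ e' := le_inf (snd_le_of_isCut he) (snd_le_of_isCut he')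
  have hlt : e ⊓ e' < e := lt_of_le_of_ne inf_le_left fun h1 => h (inf_eq_left.mp h1)
  rcases (hp.fst_le_snd.trans hle).eq_or_lt with h1 | h1
  · rcases hp.2 with ⟨h4, -⟩ | ⟨-, h4⟩
    · exact absurd (h1 ▸ hbr) h4
    · exact absurd (h1 ▸ hle) h4.lt.not_ge
  · exact absurd hlt (h3 _ (hK.branch_mem _ hbr) h1)

/-- If a path that descends from the root vertex of a piece meets a further cut vertex, the topmost
one belongs to the piece. -/
lemma IsIndex.exists_isCut_le {p : T × T} (hp : IsIndex M K p) {u x : T} (hu : u ∈ K)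
    (hpu : p.1 < u) (hux : u ≤ x) (hx : p.2 ≤ x) : ∃ e, IsCut K p e ∧ e ≤ u := by
  obtain ⟨e, heu, he⟩ := Finite.exists_le_minimal (p := fun w => w ∈ K ∧ p.1 < w) ⟨hu, hpu⟩
  refine ⟨e, ⟨he.prop.1, Or.inr ⟨he.prop.2, hp.snd_le_of_lt he.prop.2 (heu.trans hux) hx,
    fun w hw hpw hwe => ?_⟩, he.prop.2⟩, heu⟩
  exact hwe.not_ge (he.le_of_le ⟨hw, hpw⟩ hwe.le)

lemma IsIndex.exists_isCut (hK : IsCutSet M K) {p : T × T} (hp : IsIndex M K p)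
    (htip : ¬ IsTip M p.1) : ∃ e, IsCut K p e := by
  obtain ⟨h, hph, hsh, hh⟩ : ∃ h, p.1 < h ∧ p.2 ≤ h ∧ IsHeavy M h := by
    rcases hp.2 with ⟨-, h⟩ | ⟨h1, h⟩
    · by_contra! hcon
      exact htip ⟨hK.heavy _ hp.1, fun y hy => hcon y hy.lt (h ▸ hy.le)⟩
    · exact ⟨p.2, h.lt, le_rfl, h1.2 _ h⟩
  obtain ⟨t, ht, hht⟩ := hh.exists_tip
  obtain ⟨e, he, -⟩ := hp.exists_isCut_le (hK.tip_mem t ht) (hph.trans_le hht) le_rfl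
    (hsh.trans hht)
  exact ⟨e, he⟩

lemma IsTip.snd_eq (I : Inst T) {p : T × T} (hp : IsIndex M K p) (h : IsTip M p.1) :
    p.2 = p.1 := by
  rcases hp.2 with ⟨-, h1⟩ | ⟨h1, -⟩
  · exact h1
  · exact absurd h1 (h.not_isBranch I)

lemma IsTip.mem_piece (I : Inst T) (hK : IsCutSet M K) {p : T × T} (hp : IsIndex M K p)
    (h : IsTip M p.1) {v : T} (hv : p.1 ≤ v) : v ∈ piece K p := by
  rcases hv.eq_or_lt with h1 | h1
  · exact Or.inl h1.symm
  · exact Or.inr ⟨h1, (h.snd_eq I hp).trans_le hv,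
      fun u hu hpu _ => h.not_isHeavy hpu (hK.heavy u hu)⟩

lemma isLeafComp_pieceGraph_iff (I : Inst T) (hM : 1 < M) (hK : IsCutSet M K) {p : T × T}
    (hp : IsIndex M K p) : IsLeafComp (pieceGraph K p) ↔ IsTip M p.1 := by
  refine ⟨fun h => ?_, fun h => ⟨p.1, isRootOf_pieceGraph p, fun v hv => h.mem_piece I hK hp hv⟩⟩
  by_contra htip
  obtain ⟨r, hr, hall⟩ := h
  obtain rfl := hr.unique (isRootOf_pieceGraph p)
  obtain ⟨e, he, -, hpe⟩ := hp.exists_isCut hK htip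
  obtain ⟨x, hx⟩ := not_isMax_iff.mp ((hK.heavy e he).not_isMax hM)
  exact (mem_piece_of_lt (hall x (hpe.trans hx).le) (hpe.trans hx).ne).2.2 e he hpe hx

lemma numTerminals_tip (I : Inst T) (hK : IsCutSet M K) {p : T × T} (hp : IsIndex M K p)
    (h : IsTip M p.1) : numTerminals (pieceGraph K p) = numBelow p.1 :=
  congrArg count (funext fun _ => propext
    ⟨fun hx => le_of_mem_piece hx, fun hx => h.mem_piece I hK hp hx⟩)

lemma numTerminals_add (I : Inst T) (hM : 1 < M) (hK : IsCutSet M K) {p : T × T}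
    (hp : IsIndex M K p) {e : T} (he : IsCut K p e) :
    numTerminals (pieceGraph K p) + numBelow e = numBelow p.2 := by
  classical
  have hiff : ∀ x : Terminal T, x.1 ∈ piece K p ↔ p.2 ≤ x.1 ∧ ¬ e ≤ x.1 := by
    intro x
    have hne : p.1 ≠ x.1 := fun h => (hK.heavy _ hp.1).not_isMax hM (h ▸ x.2)
    constructor
    · intro hx
      obtain ⟨-, h2, h3⟩ := mem_piece_of_lt hx hne
      refine ⟨h2, fun hex => ?_⟩
      rcases hex.eq_or_lt with h | h
      · exact (hK.heavy _ he.1).not_isMax hM (h ▸ x.2)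
      · exact h3 e he.1 he.2.2 h
    · rintro ⟨h1, h2⟩
      refine Or.inr ⟨lt_of_le_of_ne (hp.fst_le_snd.trans h1) hne, h1, fun u hu hpu hux => ?_⟩
      obtain ⟨e', he', hle⟩ := hp.exists_isCut_le hu hpu hux.le h1
      rw [hp.isCut_unique I hK he he'] at h2
      exact h2 (hle.trans hux.le)
  have h1 : numTerminals (pieceGraph K p) = count (fun x : Terminal T => p.2 ≤ x.1 ∧ ¬ e ≤ x.1) :=
    congrArg count (funext fun x => propext (hiff x))
  rw [h1, numBelow, numBelow, count_eq_card, count_eq_card, count_eq_card,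
    ← card_filter_add_card_filter_not (s := ({x : Terminal T | p.2 ≤ x.1} : Finset _))
      (fun x => e ≤ x.1), filter_filter, filter_filter, add_comm]
  congr 2
  ext x
  simp only [mem_filter, mem_univ, true_and]
  exact ⟨fun h => ⟨(snd_le_of_isCut he).trans h, h⟩, fun h => h.2⟩

lemma numTerminals_pieceGraph_le (I : Inst T) (hM : 1 < M) (hK : IsCutSet M K) {p : T × T}
    (hp : IsIndex M K p) : (numTerminals (pieceGraph K p) : ℝ) ≤ 2 * M := by
  by_cases htip : IsTip M p.1
  · rw [numTerminals_tip I hK hp htip]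
    obtain ⟨y, z, -, hy, hz, hall⟩ := I.exists_children (htip.1.not_isMax hM)
    have h1 : (numBelow p.1 : ℝ) ≤ numBelow y + numBelow z := by
      exact_mod_cast numBelow_le_add (htip.1.not_isMax hM) hall
    have h2 : (numBelow y : ℝ) < M := not_le.mp (htip.2 y hy)
    have h3 : (numBelow z : ℝ) < M := not_le.mp (htip.2 z hz)
    linarith
  · obtain ⟨e, he⟩ := hp.exists_isCut hK htip
    have h3 := (mem_piece_of_lt he.2.1 he.2.2.ne).2.2
    have h1 : (numTerminals (pieceGraph K p) : ℝ) + numBelow e = numBelow p.2 := by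
      exact_mod_cast numTerminals_add I hM hK hp he
    have h2 := hK.gap p.2 e (hp.snd_isHeavy hK) (hK.heavy e he.1) (snd_le_of_isCut he)
      (fun u hu hue hbr => ?_) fun u hu hsu => h3 u hu (hp.fst_le_snd.trans_lt hsu)
    · linarith
    · rcases (hp.fst_le_snd.trans hu).eq_or_lt with h4 | h4
      · rcases hp.2 with ⟨h5, -⟩ | ⟨-, h5⟩
        · exact h5 (h4 ▸ hbr)
        · exact absurd (h4 ▸ hu) h5.lt.not_ge
      · exact h3 u (hK.branch_mem u hbr) h4 hue

/-- If the cut set is minimal and a piece with an optional cut vertex `e` has less than `M`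
terminals, then the piece below `e` has at least `M` terminals. -/
lemma le_numTerminals_below (I : Inst T) (hM : 1 < M) (hKmin : Minimal (IsCutSet M) K)
    {p q : T × T} (hp : IsIndex M K p) (hq : IsIndex M K q) {e : T} (he : IsCut K p e)
    (hqe : q.1 = e) (hbr : ¬ IsBranch M e) (htip : ¬ IsTip M e)
    (hsmall : (numTerminals (pieceGraph K p) : ℝ) < M) : M ≤ numTerminals (pieceGraph K q) := by
  have hK := hKmin.prop
  subst hqe
  obtain ⟨x, y, hxe, hey, hy, hxy, hgap, hlt⟩ := exists_gap_of_minimal hKmin he.1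
    (bot_le.trans_lt he.2.2).ne' hbr htip
  have hq2 : q.2 = q.1 := by
    rcases hq.2 with ⟨-, h⟩ | ⟨h, -⟩
    · exact h
    · exact absurd h hbr
  have hpx : p.1 ≤ x := by
    rcases le_or_le_of_le he.2.2.le hxe.le with h | h
    · exact h
    · refine (h.eq_of_not_lt fun h' => ?_).ge
      exact he.2.2.ne (hgap p.1 hp.1 h' (he.2.2.trans hey))
  have hsx : p.2 ≤ x := by
    rcases hp.2 with ⟨-, h⟩ | ⟨h, -⟩
    · exact h ▸ hpx
    · refine hp.snd_le_of_lt (lt_of_le_of_ne hpx fun h' => ?_) hxe.le (snd_le_of_isCut he)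
      exact hxy x le_rfl (hxe.trans hey) (h' ▸ h)
  obtain ⟨e', he'⟩ := hq.exists_isCut hK htip
  have hye' : y ≤ e' := by
    by_contra h
    by_cases h' : e' ≤ y
    · refine he'.2.2.ne' (hgap e' he'.1 (hxe.trans he'.2.2) (lt_of_le_of_ne h' fun h'' => h h''.ge))
    · refine hxy (y ⊓ e') (hxe.le.trans (le_inf hey.le he'.2.2.le)) ?_
        (isBranch_inf I hy (hK.heavy _ he'.1) h h')
      exact lt_of_le_of_ne inf_le_left fun h1 => h (inf_eq_left.mp h1)
  have h1 : (numTerminals (pieceGraph K p) : ℝ) + numBelow q.1 = numBelow p.2 := by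
    exact_mod_cast numTerminals_add I hM hK hp he
  have h2 : (numTerminals (pieceGraph K q) : ℝ) + numBelow e' = numBelow q.1 := by
    rw [← hq2]
    exact_mod_cast numTerminals_add I hM hK hq he'
  have h3 : (numBelow x : ℝ) ≤ numBelow p.2 := Nat.cast_le.mpr (numBelow_anti hsx)
  have h4 : (numBelow e' : ℝ) ≤ numBelow y := Nat.cast_le.mpr (numBelow_anti hye')
  linarith

end Pieces

/-! ### Existence of a decomposition -/

section Existence

open Finset

variable {T : RootedTree} [Fintype T] {M : ℝ} {K : Finset T}

/-- A piece `p` can be charged to a piece `q` in three ways: `q` is `p` itself, or hangs off the cut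
vertex `β` of `p`, or `β` is a branch vertex and `q` is the piece at the tip assigned to `β`. -/
def IsChargedTo (M : ℝ) (K : Finset T) (tip : T → T) (p q : T × T) : Fin 3 → Prop
  | 0 => q = p
  | 1 => IsCut K p q.1
  | 2 => ∃ β, IsCut K p β ∧ IsBranch M β ∧ q.1 = tip β

lemma IsIndex.eq_of_isCut {p p' : T × T} (hp : IsIndex M K p) (hp' : IsIndex M K p') {e : T}
    (h : IsCut K p e) (h' : IsCut K p' e) : p = p' :=
  hp.eq_of_mem hp' h.2.1 h.2.2.ne h'.2.1 h'.2.2.ne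

lemma IsChargedTo.unique {tip : T → T}
    (htip : ∀ b b', IsBranch M b → IsBranch M b' → tip b = tip b' → b = b') {p p' q : T × T}
    (hp : IsIndex M K p) (hp' : IsIndex M K p') {i : Fin 3} (h : IsChargedTo M K tip p q i)
    (h' : IsChargedTo M K tip p' q i) : p = p' := by
  match i, h, h' with
  | 0, h, h' => exact Eq.trans (Eq.symm h) h'
  | 1, h, h' => exact hp.eq_of_isCut hp' h h'
  | 2, ⟨β, h1, h2, h3⟩, ⟨β', h4, h5, h6⟩ =>
    obtain rfl := htip β β' h2 h5 (h3.symm.trans h6)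
    exact hp.eq_of_isCut hp' h1 h4

lemma IsTip.isIndex (I : Inst T) (hK : IsCutSet M K) {t : T} (ht : IsTip M t) :
    IsIndex M K (t, t) := ⟨hK.tip_mem t ht, Or.inl ⟨ht.not_isBranch I, rfl⟩⟩

/-- Every piece is charged to a piece with at least `M` terminals that is the piece itself or one of
its descendants. -/
lemma exists_isChargedTo (I : Inst T) (hM : 1 < M) (hKmin : Minimal (IsCutSet M) K) {tip : T → T}
    (htip : ∀ b, IsBranch M b → IsTip M (tip b) ∧ b ≤ tip b) {p : T × T} (hp : IsIndex M K p) :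
    ∃ q, IsIndex M K q ∧ M ≤ numTerminals (pieceGraph K q) ∧
      IsDescendant (pieceGraph K q) (pieceGraph K p) ∧ ∃ i, IsChargedTo M K tip p q i := by
  have hK := hKmin.prop
  by_cases hbig : M ≤ numTerminals (pieceGraph K p)
  · exact ⟨p, hp, hbig, Or.inl rfl, 0, rfl⟩
  have hnt : ¬ IsTip M p.1 := fun h => hbig (by rw [numTerminals_tip I hK hp h]; exact h.1)
  obtain ⟨e, he⟩ := hp.exists_isCut hK hnt
  have hdesc : ∀ q : T × T, e ≤ q.1 → IsDescendant (pieceGraph K q) (pieceGraph K p) :=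
    fun q hq => Or.inr ⟨e, he.2.1, fun h => he.2.2.ne ((isRootOf_pieceGraph p).unique h),
      fun u hu => hq.trans (le_of_mem_piece hu)⟩
  have htipbig : ∀ t, IsTip M t → M ≤ numTerminals (pieceGraph K (t, t)) := fun t ht => by
    rw [numTerminals_tip I hK (ht.isIndex I hK) ht]
    exact ht.1
  by_cases het : IsTip M e
  · exact ⟨(e, e), het.isIndex I hK, htipbig e het, hdesc _ le_rfl, 1, he⟩
  by_cases heb : IsBranch M e
  · obtain ⟨h1, h2⟩ := htip e heb
    exact ⟨(tip e, tip e), h1.isIndex I hK, htipbig _ h1, hdesc _ h2, 2, e, he, heb, rfl⟩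
  · have hq : IsIndex M K (e, e) := ⟨he.1, Or.inl ⟨heb, rfl⟩⟩
    exact ⟨(e, e), hq, le_numTerminals_below I hM hKmin hp hq he rfl heb het (not_le.mp hbig),
      hdesc _ le_rfl, 1, he⟩

open scoped Classical in
/-- The pieces between the cut vertices. -/
noncomputable def pieces (M : ℝ) (K : Finset T) : Finset (graph T).Subgraph :=
  ({p | IsIndex M K p} : Finset (T × T)).image (pieceGraph K)

lemma mem_pieces {c : (graph T).Subgraph} :
    c ∈ pieces M K ↔ ∃ p, IsIndex M K p ∧ pieceGraph K p = c := by
  simp [pieces]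

lemma pieces_edge_partition (hK : IsCutSet M K) {e : Sym2 T} (he : e ∈ (graph T).edgeSet) :
    ∃! c, c ∈ pieces M K ∧ e ∈ c.edgeSet := by
  obtain ⟨v, hv, rfl⟩ := exists_edge he
  obtain ⟨p, hp, hvp, hne⟩ := exists_piece_mem hK hv
  refine ⟨_, ⟨mem_pieces.mpr ⟨p, hp, rfl⟩, (mem_edgeSet_pieceGraph hp hv).mpr ⟨hvp, hne⟩⟩, ?_⟩
  rintro c ⟨hc, hce⟩
  obtain ⟨q, hq, rfl⟩ := mem_pieces.mp hc
  obtain ⟨h1, h2⟩ := (mem_edgeSet_pieceGraph hq hv).mp hce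
  rw [hq.eq_of_mem hp h1 h2 hvp hne]

lemma pieces_meet {p q : T × T} (hp : IsIndex M K p) (hq : IsIndex M K q)
    (hne : p ≠ q) {v : T} (hvp : v ∈ piece K p) (hvq : v ∈ piece K q) : v = p.1 ∨ IsCut K p v := by
  by_cases h : p.1 = v
  · exact Or.inl h.symm
  by_cases h' : q.1 = v
  · exact Or.inr ⟨h' ▸ hq.1, hvp, lt_of_le_of_ne (le_of_mem_piece hvp) h⟩
  · exact absurd (hp.eq_of_mem hq hvp h hvq h') hne

lemma pieces_isExitOf (I : Inst T) (hM : 1 < M) (hK : IsCutSet M K) {p : T × T}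
    (hp : IsIndex M K p) {e : T} (he : IsCut K p e) :
    IsExitOf (pieces M K) (pieceGraph K p) e := by
  refine ⟨he.2.1, fun h => he.2.2.ne ((isRootOf_pieceGraph p).unique h), ?_, ?_⟩
  · obtain ⟨x, hx⟩ := not_isMax_iff.mp ((hK.heavy e he.1).not_isMax hM)
    obtain ⟨s, hs, -⟩ := exists_index M he.1 hx
    refine ⟨_, mem_pieces.mpr ⟨_, hs, rfl⟩, fun h => he.2.2.ne ?_, root_mem_piece (e, s)⟩
    rw [← pieceGraph_injective hM hK hs hp h]
  · intro c hc hne v hvp hvq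
    obtain ⟨q, hq, rfl⟩ := mem_pieces.mp hc
    rcases pieces_meet hp hq (fun h => hne (h ▸ rfl)) hvp hvq with rfl | h
    · exact Or.inl (isRootOf_pieceGraph p)
    · exact Or.inr (hp.isCut_unique I hK h he)

lemma pieces_leaf_meets (I : Inst T) (hM : 1 < M) (hK : IsCutSet M K) {p q : T × T}
    (hp : IsIndex M K p) (hleaf : IsLeafComp (pieceGraph K p)) (hq : IsIndex M K q) (hne : p ≠ q)
    {v : T} (hvp : v ∈ piece K p) (hvq : v ∈ piece K q) : v = p.1 := by
  have htip := (isLeafComp_pieceGraph_iff I hM hK hp).mp hleaf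
  exact (pieces_meet hp hq hne hvp hvq).resolve_right fun h =>
    htip.not_isHeavy h.2.2 (hK.heavy v h.1)

lemma sum_numTerminals_pieces_le (hM : 1 < M) (hK : IsCutSet M K)
    (Q : Finset (pieces M K)) : ∑ c ∈ Q, numTerminals c.1 ≤ Fintype.card (Terminal T) := by
  classical
  have h := sum_count_le Q (fun c (x : Terminal T) => x.1 ∈ c.1.verts) (fun _ => True)
    (fun _ _ _ => trivial) ?_
  · refine h.trans ?_
    rw [count_eq_card]
    exact card_filter_le _ _
  · rintro ⟨c, hc⟩ ⟨c', hc'⟩ x hx hx'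
    obtain ⟨p, hp, rfl⟩ := mem_pieces.mp hc
    obtain ⟨q, hq, rfl⟩ := mem_pieces.mp hc'
    have h : ∀ r : T × T, IsIndex M K r → r.1 ≠ x.1 := fun r hr h =>
      (hK.heavy _ hr.1).not_isMax hM (h ▸ x.2)
    exact Subtype.ext (congrArg (pieceGraph K)
      (hp.eq_of_mem hq hx (h p hp) hx' (h q hq)))

/-- For a minimal cut set, the pieces can be mapped to big pieces as a decomposition requires. -/
lemma exists_map_to_big (I : Inst T) (hM : 1 < M) (hKmin : Minimal (IsCutSet M) K) :
    ∃ f : pieces M K → pieces M K,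
      (∀ c, M ≤ numTerminals (f c).1 ∧ IsDescendant (f c).1 c.1) ∧
        ∀ b, count (fun c => f c = b) ≤ 3 := by
  classical
  obtain ⟨tip, htip, hinj⟩ := exists_tip_of_branch (M := M) I
  choose idx hidx hgraph using fun c : pieces M K => mem_pieces.mp c.2
  choose q hq hbig hdesc i hi using fun c : pieces M K =>
    exists_isChargedTo I hM hKmin htip (hidx c)
  refine ⟨fun c => ⟨pieceGraph K (q c), mem_pieces.mpr ⟨_, hq c, rfl⟩⟩, fun c =>
    ⟨hbig c, by simpa only [hgraph] using hdesc c⟩, fun b => ?_⟩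
  rw [count_eq_card, ← Fintype.card_fin 3, ← card_univ]
  refine card_le_card_of_injOn i (fun _ _ => mem_univ _) fun c hc c' hc' h => ?_
  have h1 := congrArg Subtype.val ((mem_filter.mp hc).2.trans (mem_filter.mp hc').2.symm)
  have h2 := pieceGraph_injective hM hKmin.prop (hq c) (hq c') h1
  have h3 := IsChargedTo.unique hinj (hidx c) (hidx c') (hi c) (h2 ▸ h ▸ hi c')
  exact Subtype.ext (by rw [← hgraph c, ← hgraph c', h3])

lemma mul_card_pieces_le (I : Inst T) (hM : 1 < M) (hKmin : Minimal (IsCutSet M) K) :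
    M * #(pieces M K) ≤ 3 * Fintype.card (Terminal T) := by
  classical
  obtain ⟨f, hf, hfib⟩ := exists_map_to_big I hM hKmin
  have h1 := card_le_mul_card_image_of_maps_to (s := (univ : Finset (pieces M K)))
    (t := {b | M ≤ numTerminals b.1}) (f := f) (fun c _ => by simpa using (hf c).1) 3
    fun b _ => (count_eq_card _).symm.trans_le (hfib b)
  rw [card_univ, Fintype.card_coe] at h1
  have h2 : #({b | M ≤ numTerminals b.1} : Finset (pieces M K)) * M ≤
      ∑ b : pieces M K with M ≤ numTerminals b.1, (numTerminals b.1 : ℝ) := by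
    rw [← nsmul_eq_mul]
    exact card_nsmul_le_sum _ _ _ fun b hb => (mem_filter.mp hb).2
  have h3 : ∑ b : pieces M K with M ≤ numTerminals b.1, (numTerminals b.1 : ℝ) ≤
      Fintype.card (Terminal T) := by
    exact_mod_cast sum_numTerminals_pieces_le hM hKmin.prop _
  have h4 : (#(pieces M K) : ℝ) ≤
      3 * #({b | M ≤ numTerminals b.1} : Finset (pieces M K)) := by exact_mod_cast h1
  nlinarith

/-- A tree with at most `2 Γ k` terminals can be a single component. -/
lemma isDecomposition_singleton_top {ε : ℝ} {k : ℕ} (hbot : ¬ IsMax (⊥ : T))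
    (hsmall : (numBelow (⊥ : T) : ℝ) ≤ 2 * Gam ε * k) :
    IsDecomposition ε k {(⊤ : (graph T).Subgraph)} where
  edges_nonempty c hc := by
    obtain rfl := mem_singleton.mp hc
    obtain ⟨x, hx⟩ := not_isMax_iff.mp hbot
    exact ⟨_, SimpleGraph.Subgraph.mem_edgeSet.mpr
      (show (⊤ : (graph T).Subgraph).Adj _ x from pred_adj hx.ne')⟩
  edge_partition e he := ⟨⊤, ⟨mem_singleton_self _, by simpa using he⟩,
    fun c hc => mem_singleton.mp hc.1⟩
  connected c hc := by
    obtain rfl := mem_singleton.mp hc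
    exact connected_of_pred_adj (r := ⊥) trivial fun v _ hv => ⟨pred_adj hv, hv⟩
  leaf_meets c hc _ c' hc' hne :=
    absurd ((mem_singleton.mp hc').trans (mem_singleton.mp hc).symm) hne
  internal_exit c hc h := by
    obtain rfl := mem_singleton.mp hc
    exact absurd ⟨⊥, ⟨trivial, fun _ _ => bot_le⟩, fun _ _ => trivial⟩ h
  terminals_le c hc := by
    obtain rfl := mem_singleton.mp hc
    refine le_trans (Nat.cast_le.mpr (count_mono fun x _ => ?_)) hsmall
    exact bot_le
  leaf_big h := absurd h (by simp)
  map_to_big h := absurd h (by simp)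
  card_le h := absurd h (by simp)

lemma isDecomposition_pieces (I : Inst T) {ε : ℝ} {k : ℕ} (hε : 0 < ε) (hk : 0 < k)
    (hM : 1 < Gam ε * k) {K : Finset T} (hKmin : Minimal (IsCutSet (Gam ε * k)) K) :
    IsDecomposition ε k (pieces (Gam ε * k) K) where
  edges_nonempty c hc := by
    obtain ⟨p, hp, rfl⟩ := mem_pieces.mp hc
    exact pieceGraph_edges_nonempty hM hKmin.prop hp
  edge_partition _ he := pieces_edge_partition hKmin.prop he
  connected c hc := by
    obtain ⟨p, hp, rfl⟩ := mem_pieces.mp hc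
    exact pieceGraph_connected hp
  leaf_meets c hc hleaf c' hc' hne v hv hv' := by
    obtain ⟨p, hp, rfl⟩ := mem_pieces.mp hc
    obtain ⟨q, hq, rfl⟩ := mem_pieces.mp hc'
    rw [pieces_leaf_meets I hM hKmin.prop hp hleaf hq (fun h => hne (h ▸ rfl)) hv hv']
    exact isRootOf_pieceGraph p
  internal_exit c hc h := by
    obtain ⟨p, hp, rfl⟩ := mem_pieces.mp hc
    obtain ⟨e, he⟩ := hp.exists_isCut hKmin.prop
      fun ht => h ((isLeafComp_pieceGraph_iff I hM hKmin.prop hp).mpr ht)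
    exact ⟨e, pieces_isExitOf I hM hKmin.prop hp he⟩
  terminals_le c hc := by
    obtain ⟨p, hp, rfl⟩ := mem_pieces.mp hc
    rw [mul_assoc]
    exact numTerminals_pieceGraph_le I hM hKmin.prop hp
  leaf_big _ c hc h := by
    obtain ⟨p, hp, rfl⟩ := mem_pieces.mp hc
    have ht := (isLeafComp_pieceGraph_iff I hM hKmin.prop hp).mp h
    rw [IsBig, numTerminals_tip I hKmin.prop hp ht]
    exact ht.1
  map_to_big _ := exists_map_to_big I hM hKmin
  card_le _ := by
    have h := mul_card_pieces_le I hM hKmin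
    have hΓ : 0 < Gam ε := by unfold Gam; positivity
    have hk' : (1 : ℝ) ≤ k := by exact_mod_cast hk
    rw [div_mul_eq_mul_div, le_div_iff₀ hΓ]
    refine le_trans ?_ h
    rw [mul_comm, mul_assoc]
    refine mul_le_mul_of_nonneg_left ?_ hΓ.le
    exact le_mul_of_one_le_left (Nat.cast_nonneg _) hk'

theorem exists_decomposition (I : Inst T) {ε : ℝ} (hε : 0 < ε) (hε' : ε ≤ 1 / 32)
    (hbot : ¬ IsMax (⊥ : T)) :
    ∃ 𝒞 : Finset (graph T).Subgraph, IsDecomposition ε I.cap 𝒞 := by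
  have hk : (1 : ℝ) ≤ I.cap := by exact_mod_cast I.cap_pos
  have hΓ : 1 < Gam ε := by
    unfold Gam
    rw [lt_div_iff₀ hε]
    linarith
  have hM : 1 < Gam ε * I.cap := by nlinarith
  by_cases h : IsHeavy (Gam ε * I.cap) (⊥ : T)
  · obtain ⟨K, -, hK⟩ := Finite.exists_le_minimal (isCutSet_filter_isHeavy I hM h)
    exact ⟨_, isDecomposition_pieces I hε I.cap_pos hM hK⟩
  · refine ⟨_, isDecomposition_singleton_top hbot ?_⟩
    have h1 : (numBelow (⊥ : T) : ℝ) < Gam ε * I.cap := not_le.mp h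
    nlinarith

end Existence

end TreeCVRP

theorem mainTheorem5 (T : RootedTree) [Fintype T] (I : TreeCVRP.Inst T) (ε : ℝ)
    (hε : 0 < ε) (hε' : ε ≤ 1 / 32) (hI : I.BoundedDistances ε) :
    (∃ 𝒞 : Finset (TreeCVRP.graph T).Subgraph, TreeCVRP.IsDecomposition ε I.cap 𝒞) ∧
    ∀ 𝒞 : Finset (TreeCVRP.graph T).Subgraph, TreeCVRP.IsDecomposition ε I.cap 𝒞 →
      ∃ (D : TreeCVRP.Dummies 𝒞) (OPT₁ : TreeCVRP.Solution T D.tokenPos I.cap),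
        (∀ c : 𝒞, (TreeCVRP.count (fun i => 0 < D.numVisited OPT₁ i c) : ℝ) ≤
          2 * TreeCVRP.Gam ε / TreeCVRP.alpha ε + 1) ∧
        (∀ (c : 𝒞) (i : Fin OPT₁.numTours), 0 < D.numVisited OPT₁ i c →
          TreeCVRP.alpha ε * I.cap ≤ D.numVisited OPT₁ i c) ∧
        I.cost OPT₁ ≤ (1 + ε) * I.opt := by
  have hbot : ¬ IsMax (⊥ : T) := fun h => TreeCVRP.Inst.terminal_ne_bot hε hI ⟨⊥, h⟩ rfl
  exact ⟨TreeCVRP.exists_decomposition I hε hε' hbot,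
    fun _ hD => TreeCVRP.exists_reduced_solution I hε hε' hI hD⟩
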